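/- Let $N\ge 2$ be an integer, $2^*=\frac{2N}{N-1}$, and $\mathbb{R}^{N+1}_+=\{(x,y): x\in\mathbb{R}^N,\ y>0\}$. All functions are real-valued. Let $H^1(\mathbb{R}^{N+1}_+)$ be the Sobolev space of functions $v\in L^2(\mathbb{R}^{N+1}_+)$ whose weak gradient $\nabla v$ is in $L^2(\mathbb{R}^{N+1}_+)$, with its usual norm, and let $$\mathcal{H}(\mathbb{R}^{N+1}_+)=\Big\{v\in H^1(\mathbb{R}^{N+1}_+):\ \iint_{\mathbb{R}^{N+1}_+}\big[|\nabla v|^2+|x|^2v^2\big]\,dx\,dy<\infty\Big\},\qquad \|v\|^2=\iint_{\mathbb{R}^{N+1}_+}\big[|\nabla v|^2+|x|^2v^2\big]\,dx\,dy .$$ **Proposition (trace embedding).** There is a unique bounded linear operator $\operatorname{tr}:H^1(\mathbb{R}^{N+1}_+)\to L^2(\mathbb{R}^N)$ with $\operatorname{tr}(\varphi|_{\mathbb{R}^{N+1}_+})=\varphi(\cdot,0)$ for all $\varphi\in C_c^\infty(\mathbb{R}^{N+1})$ (the trace operator, $v(\cdot,0):=\operatorname{tr}v$). For every $q\in[2,2^*]$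 the map $v\mapsto v(\cdot,0)$ is a well-defined continuous linear operator from $(\mathcal{H}(\mathbb{R}^{N+1}_+),\|\cdot\|)$ to $L^q(\mathbb{R}^N)$, and for every $q\in[2,2^*)$ this operator is compact. -/

import Mathlib

open MeasureTheory
open scoped ContDiff ENNReal

noncomputable section

namespace HarmonicTrace

/-- Points `(x, y)` of `ℝ^{N+1} = ℝ^N × ℝ`, with the product (Lebesgue) measure. -/
abbrev Pt (N : ℕ) : Type := EuclideanSpace ℝ (Fin N) × ℝ

/-- Values of gradients: `ℝ^N × ℝ` with the Euclidean inner product and norm. -/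
abbrev Vec (N : ℕ) : Type := WithLp 2 (EuclideanSpace ℝ (Fin N) × ℝ)

/-- The open upper half-space `{(x, y) : y > 0}`. -/
def halfSpace (N : ℕ) : Set (Pt N) := {z | 0 < z.2}

/-- Lebesgue measure on the upper half-space. -/
abbrev halfMeasure (N : ℕ) : Measure (Pt N) := (volume : Measure (Pt N)).restrict (halfSpace N)

/-- `g` is the weak gradient of `v` in the open upper half-space: integration by parts holds against
all smooth functions with compact support in the open half-space, in every direction `w`. -/
def IsWeakGradient {N : ℕ} (v : Pt N → ℝ) (g : Pt N → Vec N) : Prop :=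
  ∀ φ : Pt N → ℝ, ContDiff ℝ ∞ φ → HasCompactSupport φ → tsupport φ ⊆ halfSpace N →
    ∀ w : Pt N, ∫ z, v z * fderiv ℝ φ z w ∂(halfMeasure N) =
      -∫ z, inner ℝ (g z) (WithLp.toLp 2 w) * φ z ∂(halfMeasure N)

theorem isOpen_halfSpace (N : ℕ) : IsOpen (halfSpace N) :=
  isOpen_lt continuous_const continuous_snd

theorem memLp_fderiv_test {N : ℕ} {φ : Pt N → ℝ} (h : ContDiff ℝ ∞ φ) (hc : HasCompactSupport φ)
    (w : Pt N) : MemLp (fun z => fderiv ℝ φ z w) 2 (halfMeasure N) := by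
  have h1 : Continuous (fun z => fderiv ℝ φ z w) :=
    (h.continuous_fderiv (by simp)).clm_apply continuous_const
  have h2 : HasCompactSupport (fun z => fderiv ℝ φ z w) := hc.fderiv_apply (𝕜 := ℝ) w
  exact h1.memLp_of_hasCompactSupport h2

theorem integrable_left {N : ℕ} {φ : Pt N → ℝ} (h : ContDiff ℝ ∞ φ) (hc : HasCompactSupport φ)
    (w : Pt N) (v : Lp ℝ 2 (halfMeasure N)) :
    Integrable (fun z => v z * fderiv ℝ φ z w) (halfMeasure N) :=
  (Lp.memLp v).integrable_mul (memLp_fderiv_test h hc w)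

theorem integrable_right {N : ℕ} {φ : Pt N → ℝ} (h : ContDiff ℝ ∞ φ) (hc : HasCompactSupport φ)
    (w : Vec N) (g : Lp (Vec N) 2 (halfMeasure N)) :
    Integrable (fun z => inner ℝ (g z) w * φ z) (halfMeasure N) := by
  have h1 : MemLp φ 2 (halfMeasure N) := h.continuous.memLp_of_hasCompactSupport hc
  have h2 : MemLp (fun z => inner ℝ (g z) w) 2 (halfMeasure N) := (Lp.memLp g).inner_const w
  exact h2.integrable_mul h1

theorem IsWeakGradient.add {N : ℕ} {v v' : Lp ℝ 2 (halfMeasure N)}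
    {g g' : Lp (Vec N) 2 (halfMeasure N)} (h : IsWeakGradient v g) (h' : IsWeakGradient v' g') :
    IsWeakGradient (v + v' : Lp ℝ 2 (halfMeasure N)) (g + g' : Lp (Vec N) 2 (halfMeasure N)) := by
  intro φ hφ hc hs w
  have e1 : (fun z => (v + v' : Lp ℝ 2 (halfMeasure N)) z * fderiv ℝ φ z w) =ᵐ[halfMeasure N]
      fun z => v z * fderiv ℝ φ z w + v' z * fderiv ℝ φ z w := by
    filter_upwards [Lp.coeFn_add v v'] with z hz
    rw [hz, Pi.add_apply, add_mul]
  have e2 : (fun z => inner ℝ ((g + g' : Lp (Vec N) 2 (halfMeasure N)) z) (WithLp.toLp 2 w) * φ z)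
      =ᵐ[halfMeasure N] fun z => inner ℝ (g z) (WithLp.toLp 2 w) * φ z +
        inner ℝ (g' z) (WithLp.toLp 2 w) * φ z := by
    filter_upwards [Lp.coeFn_add g g'] with z hz
    rw [hz, Pi.add_apply, inner_add_left, add_mul]
  rw [integral_congr_ae e1, integral_congr_ae e2,
    integral_add (integrable_left hφ hc w v) (integrable_left hφ hc w v'),
    integral_add (integrable_right hφ hc _ g) (integrable_right hφ hc _ g'),
    h φ hφ hc hs w, h' φ hφ hc hs w]
  ring

theorem IsWeakGradient.smul {N : ℕ} {v : Lp ℝ 2 (halfMeasure N)}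
    {g : Lp (Vec N) 2 (halfMeasure N)} (c : ℝ) (h : IsWeakGradient v g) :
    IsWeakGradient (c • v : Lp ℝ 2 (halfMeasure N)) (c • g : Lp (Vec N) 2 (halfMeasure N)) := by
  intro φ hφ hc hs w
  have e1 : (fun z => (c • v : Lp ℝ 2 (halfMeasure N)) z * fderiv ℝ φ z w) =ᵐ[halfMeasure N]
      fun z => c * (v z * fderiv ℝ φ z w) := by
    filter_upwards [Lp.coeFn_smul c v] with z hz
    rw [hz, Pi.smul_apply, smul_eq_mul, mul_assoc]
  have e2 : (fun z => inner ℝ ((c • g : Lp (Vec N) 2 (halfMeasure N)) z) (WithLp.toLp 2 w) * φ z)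
      =ᵐ[halfMeasure N] fun z => c * (inner ℝ (g z) (WithLp.toLp 2 w) * φ z) := by
    filter_upwards [Lp.coeFn_smul c g] with z hz
    rw [hz, Pi.smul_apply, real_inner_smul_left, mul_assoc]
  rw [integral_congr_ae e1, integral_congr_ae e2, integral_const_mul, integral_const_mul,
    h φ hφ hc hs w]
  ring

theorem isWeakGradient_zero (N : ℕ) :
    IsWeakGradient (0 : Lp ℝ 2 (halfMeasure N)) (0 : Lp (Vec N) 2 (halfMeasure N)) := by
  intro φ hφ hc hs w
  have e1 : (fun z => (0 : Lp ℝ 2 (halfMeasure N)) z * fderiv ℝ φ z w) =ᵐ[halfMeasure N]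
      fun _ => 0 := by
    filter_upwards [Lp.coeFn_zero ℝ 2 (halfMeasure N)] with z hz
    rw [hz]; simp
  have e2 : (fun z => inner ℝ ((0 : Lp (Vec N) 2 (halfMeasure N)) z) (WithLp.toLp 2 w) * φ z)
      =ᵐ[halfMeasure N] fun _ => 0 := by
    filter_upwards [Lp.coeFn_zero (Vec N) 2 (halfMeasure N)] with z hz
    rw [hz]; simp
  rw [integral_congr_ae e1, integral_congr_ae e2]
  simp

/-- The weak gradient is unique. -/
theorem IsWeakGradient.unique {N : ℕ} {v : Lp ℝ 2 (halfMeasure N)}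
    {g g' : Lp (Vec N) 2 (halfMeasure N)} (h : IsWeakGradient v g) (h' : IsWeakGradient v g') :
    g = g' := by
  rw [← sub_eq_zero]
  set f : Lp (Vec N) 2 (halfMeasure N) := g - g' with hf
  have hw : IsWeakGradient (0 : Lp ℝ 2 (halfMeasure N)) f := by
    have := h.add (h'.smul (-1))
    simpa [hf, sub_eq_add_neg] using this
  have hint : LocallyIntegrable f (halfMeasure N) := (Lp.memLp f).locallyIntegrable (by norm_num)
  have hloc : LocallyIntegrableOn f (halfSpace N) volume :=
    locallyIntegrableOn_of_locallyIntegrable_restrict hint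
  have key : ∀ᵐ z ∂(volume : Measure (Pt N)), z ∈ halfSpace N → f z = 0 := by
    refine (isOpen_halfSpace N).ae_eq_zero_of_integral_contDiff_smul_eq_zero hloc ?_
    intro φ hφ hc hs
    have hsupp : ∫ z, φ z • f z = ∫ z, φ z • f z ∂(halfMeasure N) := by
      symm
      apply setIntegral_eq_integral_of_forall_compl_eq_zero
      intro z hz
      rw [image_eq_zero_of_notMem_tsupport (fun hz' => hz (hs hz')), zero_smul]
    rw [hsupp]
    have hI : Integrable (fun z => φ z • f z) (halfMeasure N) :=
      hint.integrable_smul_left_of_hasCompactSupport hφ.continuous hc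
    refine ext_inner_right ℝ fun w => ?_
    rw [inner_zero_left, real_inner_comm, ← integral_inner hI w]
    have hz := hw φ hφ hc hs (WithLp.ofLp w)
    have e1 : (fun z => (0 : Lp ℝ 2 (halfMeasure N)) z * fderiv ℝ φ z (WithLp.ofLp w))
        =ᵐ[halfMeasure N] fun _ => 0 := by
      filter_upwards [Lp.coeFn_zero ℝ 2 (halfMeasure N)] with z hz
      rw [hz]; simp
    rw [integral_congr_ae e1, integral_zero, eq_comm, neg_eq_zero] at hz
    rw [← hz]
    congr 1
    funext z
    rw [real_inner_smul_right, real_inner_comm, mul_comm]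
  rw [Lp.eq_zero_iff_ae_eq_zero]
  exact (ae_restrict_iff' (isOpen_halfSpace N).measurableSet).2 key

/-- The set of `v ∈ L²` of the half-space that have a weak gradient in `L²`, as a subspace of
`L²`. -/
def sobolevSubmodule (N : ℕ) : Submodule ℝ (Lp ℝ 2 (halfMeasure N)) where
  carrier := {v | ∃ g : Lp (Vec N) 2 (halfMeasure N), IsWeakGradient v g}
  add_mem' := fun ⟨g, hg⟩ ⟨g', hg'⟩ => ⟨g + g', hg.add hg'⟩
  zero_mem' := ⟨0, isWeakGradient_zero N⟩
  smul_mem' := fun c _ ⟨g, hg⟩ => ⟨c • g, hg.smul c⟩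

/-- The Sobolev space `H¹(ℝ^{N+1}_+)`; a separate type, because it carries the Sobolev norm and not
the norm of `L²`. -/
def SobolevH1 (N : ℕ) : Type := ↥(sobolevSubmodule N)

instance (N : ℕ) : AddCommGroup (SobolevH1 N) := inferInstanceAs (AddCommGroup (sobolevSubmodule N))

instance (N : ℕ) : Module ℝ (SobolevH1 N) := inferInstanceAs (Module ℝ (sobolevSubmodule N))

/-- The inclusion `H¹ → L²`: the function itself. -/
def SobolevH1.toL2 (N : ℕ) : SobolevH1 N →ₗ[ℝ] Lp ℝ 2 (halfMeasure N) :=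
  (sobolevSubmodule N).subtype

theorem SobolevH1.exists_weakGradient {N : ℕ} (v : SobolevH1 N) :
    ∃ g : Lp (Vec N) 2 (halfMeasure N), IsWeakGradient (SobolevH1.toL2 N v) g := v.2

/-- The weak gradient `∇ : H¹ → L²`. -/
def SobolevH1.grad (N : ℕ) : SobolevH1 N →ₗ[ℝ] Lp (Vec N) 2 (halfMeasure N) where
  toFun v := v.exists_weakGradient.choose
  map_add' v v' := by
    refine (v + v').exists_weakGradient.choose_spec.unique ?_
    rw [map_add]
    exact v.exists_weakGradient.choose_spec.add v'.exists_weakGradient.choose_spec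
  map_smul' c v := by
    refine (c • v).exists_weakGradient.choose_spec.unique ?_
    rw [map_smul]
    exact v.exists_weakGradient.choose_spec.smul c

theorem SobolevH1.isWeakGradient_grad {N : ℕ} (v : SobolevH1 N) :
    IsWeakGradient (SobolevH1.toL2 N v) (SobolevH1.grad N v) :=
  v.exists_weakGradient.choose_spec

/-- The map `v ↦ (v, ∇v)` into `L² × L²` with the Hilbert sum norm. -/
def SobolevH1.toPair (N : ℕ) : SobolevH1 N →ₗ[ℝ]
    WithLp 2 (Lp ℝ 2 (halfMeasure N) × Lp (Vec N) 2 (halfMeasure N)) :=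
  (WithLp.linearEquiv 2 ℝ
    (Lp ℝ 2 (halfMeasure N) × Lp (Vec N) 2 (halfMeasure N))).symm.toLinearMap ∘ₗ
      (SobolevH1.toL2 N).prod (SobolevH1.grad N)

theorem SobolevH1.toPair_injective (N : ℕ) : Function.Injective (SobolevH1.toPair N) := by
  intro v v' h
  have := congrArg (fun p => (WithLp.ofLp p).1) h
  exact Subtype.ext this

/-- The usual norm of `H¹`: `‖v‖² = ‖v‖²_{L²} + ‖∇v‖²_{L²}` (see `SobolevH1.norm_sq`). -/
instance (N : ℕ) : NormedAddCommGroup (SobolevH1 N) :=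
  NormedAddCommGroup.induced _ _ (SobolevH1.toPair N) (SobolevH1.toPair_injective N)

instance (N : ℕ) : NormedSpace ℝ (SobolevH1 N) :=
  NormedSpace.induced ℝ _ _ (SobolevH1.toPair N)

theorem SobolevH1.norm_sq {N : ℕ} (v : SobolevH1 N) :
    ‖v‖ ^ 2 = ‖SobolevH1.toL2 N v‖ ^ 2 + ‖SobolevH1.grad N v‖ ^ 2 :=
  WithLp.prod_norm_sq_eq_of_L2 (SobolevH1.toPair N v)

/-- The energy density `|∇v(x,y)|² + |x|² v(x,y)²`. -/
def energyDensity {N : ℕ} (v : SobolevH1 N) (z : Pt N) : ℝ :=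
  ‖SobolevH1.grad N v z‖ ^ 2 + ‖z.1‖ ^ 2 * (SobolevH1.toL2 N v z) ^ 2

theorem integrable_energyDensity_iff {N : ℕ} (v : SobolevH1 N) :
    Integrable (energyDensity v) (halfMeasure N) ↔
      MemLp (fun z : Pt N => ‖z.1‖ * SobolevH1.toL2 N v z) 2 (halfMeasure N) := by
  have hm : AEStronglyMeasurable (fun z : Pt N => ‖z.1‖ * SobolevH1.toL2 N v z)
      (halfMeasure N) :=
    (continuous_fst.norm.aestronglyMeasurable).mul (Lp.aestronglyMeasurable _)
  have hg : Integrable (fun z => ‖SobolevH1.grad N v z‖ ^ 2) (halfMeasure N) :=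
    (memLp_two_iff_integrable_sq_norm (Lp.aestronglyMeasurable _)).1 (Lp.memLp _)
  rw [memLp_two_iff_integrable_sq hm]
  have : energyDensity v = (fun z => ‖SobolevH1.grad N v z‖ ^ 2) +
      fun z : Pt N => (‖z.1‖ * SobolevH1.toL2 N v z) ^ 2 := by
    funext z
    simp only [energyDensity, Pi.add_apply, mul_pow]
  rw [this]
  exact integrable_add_iff_integrable_right' hg

/-- The functions `v ∈ H¹(ℝ^{N+1}_+)` with `∬ (|∇v|² + |x|² v²) < ∞`, as a subspace of `H¹`. -/
def energySubmodule (N : ℕ) : Submodule ℝ (SobolevH1 N) where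
  carrier := {v | Integrable (energyDensity v) (halfMeasure N)}
  add_mem' := by
    intro v v' h h'
    simp only [Set.mem_ofPred_eq, integrable_energyDensity_iff] at h h' ⊢
    refine (h.add h').ae_eq ?_
    rw [map_add]
    filter_upwards [Lp.coeFn_add (SobolevH1.toL2 N v) (SobolevH1.toL2 N v')] with z hz
    rw [hz, Pi.add_apply, Pi.add_apply, mul_add]
  zero_mem' := by
    simp only [Set.mem_ofPred_eq, integrable_energyDensity_iff]
    refine (MemLp.zero' (p := 2) (μ := halfMeasure N) (ε := ℝ)).ae_eq ?_
    rw [map_zero]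
    filter_upwards [Lp.coeFn_zero ℝ 2 (halfMeasure N)] with z hz
    rw [hz]; simp
  smul_mem' := by
    intro c v h
    simp only [Set.mem_ofPred_eq, integrable_energyDensity_iff] at h ⊢
    refine (h.const_mul c).ae_eq ?_
    rw [map_smul]
    filter_upwards [Lp.coeFn_smul c (SobolevH1.toL2 N v)] with z hz
    rw [hz, Pi.smul_apply, smul_eq_mul]; ring

/-- The energy space `𝓗(ℝ^{N+1}_+)`; a separate type, because its norm is not that of `H¹`. -/
def EnergySpace (N : ℕ) : Type := ↥(energySubmodule N)

instance (N : ℕ) : AddCommGroup (EnergySpace N) :=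
  inferInstanceAs (AddCommGroup (energySubmodule N))

instance (N : ℕ) : Module ℝ (EnergySpace N) := inferInstanceAs (Module ℝ (energySubmodule N))

/-- The inclusion `𝓗 → H¹`. -/
def EnergySpace.toH1 (N : ℕ) : EnergySpace N →ₗ[ℝ] SobolevH1 N := (energySubmodule N).subtype

theorem EnergySpace.memLp_weighted {N : ℕ} (v : EnergySpace N) :
    MemLp (fun z : Pt N => ‖z.1‖ * SobolevH1.toL2 N (EnergySpace.toH1 N v) z) 2
      (halfMeasure N) :=
  (integrable_energyDensity_iff _).1 v.2

/-- The map `v ↦ |x| v` from `𝓗` to `L²`. -/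
def EnergySpace.weighted (N : ℕ) : EnergySpace N →ₗ[ℝ] Lp ℝ 2 (halfMeasure N) where
  toFun v := v.memLp_weighted.toLp _
  map_add' v v' := by
    rw [← MemLp.toLp_add, MemLp.toLp_eq_toLp_iff, map_add, map_add]
    filter_upwards [Lp.coeFn_add (SobolevH1.toL2 N (EnergySpace.toH1 N v))
      (SobolevH1.toL2 N (EnergySpace.toH1 N v'))] with z hz
    rw [hz, Pi.add_apply, Pi.add_apply, mul_add]
  map_smul' c v := by
    rw [RingHom.id_apply, ← MemLp.toLp_const_smul, MemLp.toLp_eq_toLp_iff, map_smul, map_smul]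
    filter_upwards [Lp.coeFn_smul c (SobolevH1.toL2 N (EnergySpace.toH1 N v))] with z hz
    rw [hz, Pi.smul_apply, Pi.smul_apply, smul_eq_mul, smul_eq_mul]; ring

/-- The map `v ↦ (∇v, |x| v)` into `L² × L²` with the Hilbert sum norm. -/
def EnergySpace.toPair (N : ℕ) : EnergySpace N →ₗ[ℝ]
    WithLp 2 (Lp (Vec N) 2 (halfMeasure N) × Lp ℝ 2 (halfMeasure N)) :=
  (WithLp.linearEquiv 2 ℝ
    (Lp (Vec N) 2 (halfMeasure N) × Lp ℝ 2 (halfMeasure N))).symm.toLinearMap ∘ₗ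
      (SobolevH1.grad N ∘ₗ EnergySpace.toH1 N).prod (EnergySpace.weighted N)

/-- The norm `‖v‖² = ∬ (|∇v|² + |x|² v²)` (see `EnergySpace.norm_sq`). It is definite for `N ≥ 1`
(see `EnergySpace.eq_zero_of_norm_eq_zero`), hence a norm. -/
instance (N : ℕ) : SeminormedAddCommGroup (EnergySpace N) :=
  SeminormedAddCommGroup.induced _ _ (EnergySpace.toPair N)

instance (N : ℕ) : NormedSpace ℝ (EnergySpace N) :=
  NormedSpace.induced ℝ _ _ (EnergySpace.toPair N)

theorem norm_sq_toL2 {N : ℕ} {F : Type*} [NormedAddCommGroup F] (f : Lp F 2 (halfMeasure N)) :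
    ‖f‖ ^ 2 = ∫ z, ‖f z‖ ^ 2 ∂(halfMeasure N) := by
  have h := (Lp.memLp f).eLpNorm_eq_integral_rpow_norm (by norm_num) (by norm_num)
  have h0 : 0 ≤ ∫ z, ‖f z‖ ^ 2 ∂(halfMeasure N) := integral_nonneg fun z => by positivity
  rw [Lp.norm_def, h]
  simp only [ENNReal.toReal_ofNat, Real.rpow_ofNat]
  rw [ENNReal.toReal_ofReal (by positivity), ← Real.rpow_natCast, ← Real.rpow_mul h0]
  norm_num

theorem EnergySpace.norm_sq {N : ℕ} (v : EnergySpace N) :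
    ‖v‖ ^ 2 = ∫ z, energyDensity (EnergySpace.toH1 N v) z ∂(halfMeasure N) := by
  have h1 : ‖v‖ ^ 2 = ‖SobolevH1.grad N (EnergySpace.toH1 N v)‖ ^ 2 +
      ‖EnergySpace.weighted N v‖ ^ 2 :=
    WithLp.prod_norm_sq_eq_of_L2 (EnergySpace.toPair N v)
  have hw : (fun z => ‖EnergySpace.weighted N v z‖ ^ 2) =ᵐ[halfMeasure N]
      fun z => ‖z.1‖ ^ 2 * (SobolevH1.toL2 N (EnergySpace.toH1 N v) z) ^ 2 := by
    filter_upwards [v.memLp_weighted.coeFn_toLp] with z hz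
    change ‖(v.memLp_weighted.toLp _) z‖ ^ 2 = _
    rw [hz, Real.norm_eq_abs, sq_abs, mul_pow]
  have hi : Integrable (fun z => ‖EnergySpace.weighted N v z‖ ^ 2) (halfMeasure N) :=
    (memLp_two_iff_integrable_sq_norm (Lp.aestronglyMeasurable _)).1 (Lp.memLp _)
  have hg : Integrable (fun z => ‖SobolevH1.grad N (EnergySpace.toH1 N v) z‖ ^ 2)
      (halfMeasure N) :=
    (memLp_two_iff_integrable_sq_norm (Lp.aestronglyMeasurable _)).1 (Lp.memLp _)
  rw [h1, norm_sq_toL2, norm_sq_toL2, integral_congr_ae hw, ← integral_add hg (hi.congr hw)]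
  rfl

theorem EnergySpace.eq_zero_of_norm_eq_zero {N : ℕ} (hN : 1 ≤ N) {v : EnergySpace N}
    (h : ‖v‖ = 0) : v = 0 := by
  have h1 : ‖v‖ ^ 2 = ‖SobolevH1.grad N (EnergySpace.toH1 N v)‖ ^ 2 +
      ‖EnergySpace.weighted N v‖ ^ 2 :=
    WithLp.prod_norm_sq_eq_of_L2 (EnergySpace.toPair N v)
  have h2 : EnergySpace.weighted N v = 0 := by
    rw [← norm_eq_zero]
    nlinarith [sq_nonneg ‖SobolevH1.grad N (EnergySpace.toH1 N v)‖,
      norm_nonneg (EnergySpace.weighted N v)]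
  have : Nonempty (Fin N) := ⟨⟨0, hN⟩⟩
  have h3 : ∀ᵐ z ∂(halfMeasure N), z.1 ≠ 0 := by
    apply ae_restrict_of_ae
    exact (Measure.quasiMeasurePreserving_fst (μ := (volume : Measure (EuclideanSpace ℝ (Fin N))))
      (ν := (volume : Measure ℝ))).ae (Measure.ae_ne volume 0)
  have h4 : SobolevH1.toL2 N (EnergySpace.toH1 N v) = 0 := by
    rw [Lp.eq_zero_iff_ae_eq_zero]
    have h5 : (EnergySpace.weighted N v : Pt N → ℝ) =ᵐ[halfMeasure N] 0 :=
      (Lp.eq_zero_iff_ae_eq_zero).1 h2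
    filter_upwards [h3, h5, v.memLp_weighted.coeFn_toLp] with z hz hz0 hzw
    have : ‖z.1‖ * SobolevH1.toL2 N (EnergySpace.toH1 N v) z = 0 := by
      rw [← hzw]; exact hz0
    rcases mul_eq_zero.1 this with h | h
    · exact absurd (norm_eq_zero.1 h) hz
    · exact h
  exact Subtype.ext (Subtype.ext h4)

/-- Lebesgue space `L^q(ℝ^N)` on the boundary `ℝ^N ≅ ∂ℝ^{N+1}_+`. -/
abbrev BoundaryLp (N : ℕ) (q : ℝ≥0∞) : Type :=
  Lp ℝ q (volume : Measure (EuclideanSpace ℝ (Fin N)))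

/-- The trace operator `H¹(ℝ^{N+1}_+) → L²(ℝ^N)`: the bounded linear operator that maps (the
restriction to the half-space of) each smooth compactly supported function `φ` on `ℝ^{N+1}` to
`φ(·, 0)`. -/
def IsTraceOperator {N : ℕ} (tr : SobolevH1 N →L[ℝ] BoundaryLp N 2) : Prop :=
  ∀ φ : Pt N → ℝ, ContDiff ℝ ∞ φ → HasCompactSupport φ →
    ∀ v : SobolevH1 N, SobolevH1.toL2 N v =ᵐ[halfMeasure N] φ →
      tr v =ᵐ[volume] fun x => φ (x, 0)

end HarmonicTrace

end

/-!
The restrictions of functions in `C_c^∞(ℝ^{N+1})` are dense in `H¹` of the half-space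
(`denseRange_ofTest`): averaging `v` over small translations that point into the half-space gives a
function which is smooth up to the boundary and beyond, and whose gradient at interior points is the
average of `∇v`; a smooth cutoff then makes its support compact. All estimates are therefore proved
for test functions `φ` and extended by continuity, and the trace operator is the extension of
`φ ↦ φ(·, 0)`.

The fundamental theorem of calculus along the normal direction, applied to `|φ|^r`, gives
`∫_A |φ(x, 0)|^r dx ≤ r ∬_{A × (0, ∞)} |φ|^{r-1} |∇φ|` (`lintegral_boundary_rpow_le`). For `r = 2`
this is the `L²` trace inequality, localized over a set `A` of boundary points. For the critical
exponent `r = 2^*` the right-hand side is bounded by Cauchy-Schwarz and the Sobolev inequality on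
the half-space (`exists_eLpNorm_le_gradVec`), because `2(r - 1) = 2(N + 1)/(N - 1)` is the critical
Sobolev exponent in dimension `N + 1`. The half-space inequality follows from the one on the whole
space by composing with the smooth maps `(x, y) ↦ (x, √(y² + ε²))` and letting `ε → 0`.

The energy norm controls the `H¹` norm (`EnergySpace.norm_toL2_le`): a translation of length `2`
along the boundary moves the cylinder `|x| < 1` to where the weight is at least `1`, and changes `v`
in `L²` by at most `2 ‖∇v‖`. So the trace is bounded into `L²` and into `L^{2^*}`, hence into every
`L^q` in between.

For compactness in `L²`, the localized trace inequality over `{|x| ≥ R}` and the weight give uniform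
tails of size `R^{-1/2}`; the trace inequality applied to a tangential difference `v(· + k) - v`,
whose `L²` norm is at most `|k| ‖∇v‖`, gives uniform continuity under translations, of order
`|k|^{1/2}`. These two properties suffice (`isCompactOperator_of_tail_of_shift`): averages over the
cubes of a fine grid in a large ball approximate the traces uniformly by elements of a
finite-dimensional space. Interpolation with the bound in `L^{2^*}` carries compactness over to
`L^q` for `q < 2^*` (`exists_operator_Lq`).
-/

noncomputable section

namespace HarmonicTrace

open Filter Topology

open scoped NNReal

/-! ### Gradients and test functions -/

instance (N : ℕ) : (volume : Measure (Pt N)).IsAddHaarMeasure :=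
  Measure.prod.instIsAddHaarMeasure _ _

/-- The Euclidean gradient of `φ`: the Riesz representative of its derivative. -/
def gradVec {N : ℕ} (φ : Pt N → ℝ) (z : Pt N) : Vec N :=
  (InnerProductSpace.toDual ℝ (Vec N)).symm
    ((fderiv ℝ φ z).comp (WithLp.prodContinuousLinearEquiv 2 ℝ
      (EuclideanSpace ℝ (Fin N)) ℝ).toContinuousLinearMap)

theorem inner_gradVec {N : ℕ} (φ : Pt N → ℝ) (z w : Pt N) :
    inner ℝ (gradVec φ z) (WithLp.toLp 2 w) = fderiv ℝ φ z w := by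
  rw [gradVec, InnerProductSpace.toDual_symm_apply]
  rfl

theorem gradVec_unique {N : ℕ} {φ : Pt N → ℝ} {z : Pt N} {a : Vec N}
    (h : ∀ w, inner ℝ a (WithLp.toLp 2 w) = fderiv ℝ φ z w) : gradVec φ z = a := by
  refine ext_inner_right ℝ fun w => ?_
  have := inner_gradVec φ z (WithLp.ofLp w)
  rw [← h] at this
  exact this

theorem continuous_gradVec {N : ℕ} {φ : Pt N → ℝ} (h : ContDiff ℝ 1 φ) :
    Continuous (gradVec φ) :=
  (InnerProductSpace.toDual ℝ (Vec N)).symm.continuous.comp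
    ((h.continuous_fderiv one_ne_zero).clm_comp continuous_const)

theorem hasCompactSupport_gradVec {N : ℕ} {φ : Pt N → ℝ} (hc : HasCompactSupport φ) :
    HasCompactSupport (gradVec φ) := by
  refine (hc.fderiv ℝ).comp_left (g := fun L : Pt N →L[ℝ] ℝ =>
    (InnerProductSpace.toDual ℝ (Vec N)).symm (L.comp (WithLp.prodContinuousLinearEquiv 2 ℝ
      (EuclideanSpace ℝ (Fin N)) ℝ).toContinuousLinearMap)) ?_
  simp

theorem gradVec_mul {N : ℕ} {φ ψ : Pt N → ℝ} {z : Pt N} (h : DifferentiableAt ℝ φ z)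
    (h' : DifferentiableAt ℝ ψ z) :
    gradVec (fun z => φ z * ψ z) z = φ z • gradVec ψ z + ψ z • gradVec φ z := by
  refine gradVec_unique fun w => ?_
  rw [inner_add_left, real_inner_smul_left, real_inner_smul_left, inner_gradVec, inner_gradVec,
    fderiv_fun_mul h h']
  rfl

theorem abs_fderiv_le_norm_gradVec {N : ℕ} (φ : Pt N → ℝ) (z w : Pt N) :
    |fderiv ℝ φ z w| ≤ ‖gradVec φ z‖ * ‖WithLp.toLp 2 w‖ := by
  rw [← inner_gradVec]
  exact abs_real_inner_le_norm _ _

/-- The space `C_c^∞(ℝ^{N+1})`. -/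
def testFunctions (N : ℕ) : Submodule ℝ (Pt N → ℝ) where
  carrier := {φ | ContDiff ℝ ∞ φ ∧ HasCompactSupport φ}
  add_mem' h h' := ⟨h.1.add h'.1, h.2.add h'.2⟩
  zero_mem' := ⟨contDiff_const, HasCompactSupport.zero⟩
  smul_mem' c _ h := ⟨h.1.const_smul c, h.2.smul_left (f := fun _ => c)⟩

theorem testFunctions.contDiff {N : ℕ} (φ : testFunctions N) : ContDiff ℝ ∞ (φ : Pt N → ℝ) := φ.2.1

theorem testFunctions.contDiff_one {N : ℕ} (φ : testFunctions N) :
    ContDiff ℝ 1 (φ : Pt N → ℝ) := φ.2.1.of_le (by simp)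

theorem testFunctions.differentiable {N : ℕ} (φ : testFunctions N) :
    Differentiable ℝ (φ : Pt N → ℝ) := φ.2.1.differentiable (by simp)

theorem testFunctions.hasCompactSupport {N : ℕ} (φ : testFunctions N) :
    HasCompactSupport (φ : Pt N → ℝ) := φ.2.2

theorem testFunctions.memLp {N : ℕ} (φ : testFunctions N) :
    MemLp (φ : Pt N → ℝ) 2 (halfMeasure N) :=
  (testFunctions.contDiff φ).continuous.memLp_of_hasCompactSupport
    (testFunctions.hasCompactSupport φ)

theorem testFunctions.memLp_gradVec {N : ℕ} (φ : testFunctions N) :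
    MemLp (gradVec (φ : Pt N → ℝ)) 2 (halfMeasure N) :=
  (continuous_gradVec (testFunctions.contDiff_one φ)).memLp_of_hasCompactSupport
    (hasCompactSupport_gradVec (testFunctions.hasCompactSupport φ))

theorem IsWeakGradient.congr_ae {N : ℕ} {v v' : Pt N → ℝ} {g g' : Pt N → Vec N}
    (h : IsWeakGradient v g) (hv : v =ᵐ[halfMeasure N] v') (hg : g =ᵐ[halfMeasure N] g') :
    IsWeakGradient v' g' := by
  intro φ hφ hc hs w
  have := h φ hφ hc hs w
  have e1 : (fun z => v z * fderiv ℝ φ z w) =ᵐ[halfMeasure N] fun z => v' z * fderiv ℝ φ z w := by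
    filter_upwards [hv] with z hz
    rw [hz]
  have e2 : (fun z => inner ℝ (g z) (WithLp.toLp 2 w) * φ z) =ᵐ[halfMeasure N]
      fun z => inner ℝ (g' z) (WithLp.toLp 2 w) * φ z := by
    filter_upwards [hg] with z hz
    rw [hz]
  rwa [integral_congr_ae e1, integral_congr_ae e2] at this

/-- The classical gradient of a smooth function is its weak gradient. -/
theorem isWeakGradient_gradVec {N : ℕ} {u : Pt N → ℝ} (hu : ContDiff ℝ ∞ u) :
    IsWeakGradient u (gradVec u) := by
  intro φ hφ hc hs w
  have hu1 : Continuous fun z => fderiv ℝ u z w :=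
    (hu.continuous_fderiv (by simp)).clm_apply continuous_const
  have hφ1 : Continuous fun z => fderiv ℝ φ z w :=
    (hφ.continuous_fderiv (by simp)).clm_apply continuous_const
  have hc1 : HasCompactSupport fun z => fderiv ℝ φ z w := hc.fderiv_apply (𝕜 := ℝ) w
  have key := integral_mul_fderiv_eq_neg_fderiv_mul_of_integrable (μ := (volume : Measure (Pt N)))
    (f := u) (g := φ) (v := w)
    ((hu1.mul hφ.continuous).integrable_of_hasCompactSupport hc.mul_left)
    ((hu.continuous.mul hφ1).integrable_of_hasCompactSupport hc1.mul_left)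
    ((hu.continuous.mul hφ.continuous).integrable_of_hasCompactSupport hc.mul_left)
    (fun x _ => hu.differentiable (by simp) x) (fun x _ => hφ.differentiable (by simp) x)
  have e1 : ∀ z, z ∉ halfSpace N → φ z = 0 := fun z hz =>
    image_eq_zero_of_notMem_tsupport fun h => hz (hs h)
  have e2 : ∀ z, z ∉ halfSpace N → fderiv ℝ φ z w = 0 := fun z hz => by
    have : fderiv ℝ φ z = 0 := by
      by_contra h
      exact hz (hs (support_fderiv_subset ℝ h))
    simp [this]
  rw [setIntegral_eq_integral_of_forall_compl_eq_zero fun z hz => by rw [e2 z hz, mul_zero],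
    setIntegral_eq_integral_of_forall_compl_eq_zero fun z hz => by rw [e1 z hz, mul_zero], key]
  simp only [inner_gradVec]

/-- A pair `(f, g)` of square-integrable functions with `g` the weak gradient of `f` gives an
element of `H¹`. -/
def SobolevH1.mk {N : ℕ} (f : Pt N → ℝ) (g : Pt N → Vec N) (hf : MemLp f 2 (halfMeasure N))
    (hg : MemLp g 2 (halfMeasure N)) (h : IsWeakGradient f g) : SobolevH1 N :=
  ⟨hf.toLp f, hg.toLp g, h.congr_ae hf.coeFn_toLp.symm hg.coeFn_toLp.symm⟩

theorem SobolevH1.grad_mk {N : ℕ} {f : Pt N → ℝ} {g : Pt N → Vec N}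
    (hf : MemLp f 2 (halfMeasure N)) (hg : MemLp g 2 (halfMeasure N)) (h : IsWeakGradient f g) :
    SobolevH1.grad N (SobolevH1.mk f g hf hg h) = hg.toLp g :=
  (SobolevH1.isWeakGradient_grad _).unique
    (h.congr_ae hf.coeFn_toLp.symm hg.coeFn_toLp.symm)

theorem SobolevH1.toL2_injective {N : ℕ} : Function.Injective (SobolevH1.toL2 N) :=
  Subtype.val_injective

/-- Restriction to the half-space `C_c^∞(ℝ^{N+1}) → H¹(ℝ^{N+1}_+)`. -/
def ofTest (N : ℕ) : testFunctions N →ₗ[ℝ] SobolevH1 N where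
  toFun φ := SobolevH1.mk φ (gradVec φ) (testFunctions.memLp φ) (testFunctions.memLp_gradVec φ)
    (isWeakGradient_gradVec (testFunctions.contDiff φ))
  map_add' φ ψ := SobolevH1.toL2_injective
    (MemLp.toLp_add (testFunctions.memLp φ) (testFunctions.memLp ψ))
  map_smul' c φ := SobolevH1.toL2_injective (MemLp.toLp_const_smul c (testFunctions.memLp φ))

theorem toL2_ofTest {N : ℕ} (φ : testFunctions N) :
    SobolevH1.toL2 N (ofTest N φ) = (testFunctions.memLp φ).toLp _ := rfl

theorem grad_ofTest {N : ℕ} (φ : testFunctions N) :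
    SobolevH1.grad N (ofTest N φ) = (testFunctions.memLp_gradVec φ).toLp _ :=
  SobolevH1.grad_mk _ _ (isWeakGradient_gradVec (testFunctions.contDiff φ))

theorem SobolevH1.norm_toL2_le {N : ℕ} (v : SobolevH1 N) : ‖SobolevH1.toL2 N v‖ ≤ ‖v‖ :=
  le_of_sq_le_sq (by rw [v.norm_sq]; nlinarith [sq_nonneg ‖SobolevH1.grad N v‖]) (norm_nonneg _)

theorem SobolevH1.norm_grad_le {N : ℕ} (v : SobolevH1 N) : ‖SobolevH1.grad N v‖ ≤ ‖v‖ :=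
  le_of_sq_le_sq (by rw [v.norm_sq]; nlinarith [sq_nonneg ‖SobolevH1.toL2 N v‖]) (norm_nonneg _)

theorem SobolevH1.norm_le_add {N : ℕ} (v : SobolevH1 N) :
    ‖v‖ ≤ ‖SobolevH1.toL2 N v‖ + ‖SobolevH1.grad N v‖ := by
  refine le_of_sq_le_sq ?_ (by positivity)
  rw [v.norm_sq]
  nlinarith [norm_nonneg (SobolevH1.grad N v), norm_nonneg (SobolevH1.toL2 N v)]

theorem SobolevH1.continuous_toL2 (N : ℕ) : Continuous (SobolevH1.toL2 N) :=
  AddMonoidHomClass.continuous_of_bound (SobolevH1.toL2 N) 1 fun v => by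
    simpa using v.norm_toL2_le

theorem SobolevH1.continuous_grad (N : ℕ) : Continuous (SobolevH1.grad N) :=
  AddMonoidHomClass.continuous_of_bound (SobolevH1.grad N) 1 fun v => by
    simpa using v.norm_grad_le

/-! ### Translations and mollification in `L²` -/

/-- Cauchy-Schwarz for Lebesgue integrals, with natural powers. -/
theorem sq_lintegral_mul_le {α : Type*} [MeasurableSpace α] (μ : Measure α) {f g : α → ℝ≥0∞}
    (hf : AEMeasurable f μ) (hg : AEMeasurable g μ) :
    (∫⁻ a, f a * g a ∂μ) ^ 2 ≤ (∫⁻ a, f a ^ 2 ∂μ) * ∫⁻ a, g a ^ 2 ∂μ := by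
  have h := ENNReal.lintegral_mul_le_Lp_mul_Lq μ Real.HolderConjugate.two_two hf hg
  calc (∫⁻ a, f a * g a ∂μ) ^ 2
      ≤ ((∫⁻ a, f a ^ (2 : ℝ) ∂μ) ^ (1 / 2 : ℝ) * (∫⁻ a, g a ^ (2 : ℝ) ∂μ) ^ (1 / 2 : ℝ)) ^ 2 :=
        pow_le_pow_left' h 2
    _ = _ := by
        rw [mul_pow, ← ENNReal.rpow_natCast, ← ENNReal.rpow_natCast, ← ENNReal.rpow_mul,
          ← ENNReal.rpow_mul]
        norm_num

theorem sq_lintegral_le {α : Type*} [MeasurableSpace α] (μ : Measure α) {f : α → ℝ≥0∞}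
    (hf : AEMeasurable f μ) :
    (∫⁻ a, f a ∂μ) ^ 2 ≤ μ Set.univ * ∫⁻ a, f a ^ 2 ∂μ := by
  have h := sq_lintegral_mul_le μ (f := fun _ => 1) aemeasurable_const hf
  simpa using h

theorem eLpNorm_two_sq {α F : Type*} [MeasurableSpace α] [NormedAddCommGroup F] (f : α → F)
    (μ : Measure α) : eLpNorm f 2 μ ^ 2 = ∫⁻ a, ‖f a‖ₑ ^ 2 ∂μ := by
  have := eLpNorm_nnreal_pow_eq_lintegral (f := f) (μ := μ) (p := 2) (by norm_num)
  simp only [NNReal.coe_ofNat, ENNReal.rpow_ofNat] at this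
  exact this

section Mollify

variable {G F : Type*} [NormedAddCommGroup G] [NormedSpace ℝ G] [FiniteDimensional ℝ G]
  [MeasurableSpace G] [BorelSpace G] (μ : Measure G) [μ.IsAddHaarMeasure]
  [NormedAddCommGroup F]

/-- Translations act continuously on `L²`. -/
theorem tendsto_eLpNorm_translate_sub {V : G → F} (hV : MemLp V 2 μ) :
    Tendsto (fun k => eLpNorm (fun z => V (z - k) - V z) 2 μ) (𝓝 0) (𝓝 0) := by
  have hmp : ∀ k : G, MeasurePreserving (fun z => z - k) μ μ := fun k =>
    measurePreserving_sub_right μ k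
  let g : G → C(G, G) := fun k => ⟨fun z => z - k, by fun_prop⟩
  have hg : Continuous g := ContinuousMap.continuous_of_continuous_uncurry _ (by
    change Continuous fun p : G × G => p.2 - p.1
    fun_prop)
  have hc : Continuous fun k => Lp.compMeasurePreserving (g k) (hmp k) (hV.toLp V) :=
    Continuous.compMeasurePreservingLp continuous_const hg hmp (by norm_num)
  have h0 : Lp.compMeasurePreserving (g 0) (hmp 0) (hV.toLp V) = hV.toLp V := by
    rw [Lp.toLp_compMeasurePreserving]
    congr 1
    funext z
    simp [g]
  have h1 := (tendsto_iff_edist_tendsto_0.1 (hc.tendsto 0))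
  refine h1.congr fun k => ?_
  rw [h0, Lp.toLp_compMeasurePreserving, Lp.edist_toLp_toLp]
  rfl

variable [NormedSpace ℝ F] [CompleteSpace F]

/-- The average of `V` over translates, weighted by the kernel `κ`. -/
def mollify (κ : G → ℝ) (V : G → F) (z : G) : F := ∫ k, κ k • V (z - k) ∂μ

variable {μ}

/-- A mollification is as close to `V` as the translates of `V` by vectors in the support of the
kernel are; this is Cauchy-Schwarz for the probability density `κ`, followed by Tonelli. -/
theorem eLpNorm_mollify_sub_le {κ : G → ℝ} (hκ : Continuous κ) (hκ0 : ∀ k, 0 ≤ κ k)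
    (hκc : HasCompactSupport κ) (hκ1 : ∫ k, κ k ∂μ = 1) {V : G → F} (hV : MemLp V 2 μ)
    (hVm : StronglyMeasurable V) {ε : ℝ≥0∞}
    (hε : ∀ k ∈ Function.support κ, eLpNorm (fun z => V (z - k) - V z) 2 μ ≤ ε) :
    eLpNorm (fun z => mollify μ κ V z - V z) 2 μ ≤ ε := by
  have hκi : Integrable κ μ := hκ.integrable_of_hasCompactSupport hκc
  have hκm : Measurable fun k => ‖κ k‖ₑ := hκ.measurable.enorm
  have hone : ∫⁻ k, ‖κ k‖ₑ ∂μ = 1 := by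
    have : ∫⁻ k, ‖κ k‖ₑ ∂μ = ∫⁻ k, ENNReal.ofReal (κ k) ∂μ :=
      lintegral_congr fun k => Real.enorm_of_nonneg (hκ0 k)
    rw [this, ← ofReal_integral_eq_lintegral_ofReal hκi (ae_of_all _ hκ0), hκ1, ENNReal.ofReal_one]
  have hVm2 : Measurable fun p : G × G => ‖V (p.1 - p.2) - V p.1‖ₑ :=
    ((hVm.comp_measurable (measurable_fst.sub measurable_snd)).sub
      (hVm.comp_measurable measurable_fst)).enorm
  have hpt : ∀ z, ‖mollify μ κ V z - V z‖ₑ ^ 2 ≤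
      ∫⁻ k, ‖κ k‖ₑ * ‖V (z - k) - V z‖ₑ ^ 2 ∂μ := by
    intro z
    have hint : Integrable (fun k => κ k • V (z - k)) μ := by
      have h1 : LocallyIntegrable (fun k => V (z - k)) μ :=
        (hV.comp_measurePreserving (μ.measurePreserving_sub_left z)).locallyIntegrable
          (by norm_num)
      exact h1.integrable_smul_left_of_hasCompactSupport hκ hκc
    have e : mollify μ κ V z - V z = ∫ k, κ k • (V (z - k) - V z) ∂μ := by
      simp only [smul_sub]
      rw [integral_sub hint (hκi.smul_const _), integral_smul_const, hκ1, one_smul]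
      rfl
    have hz : Measurable fun k => ‖V (z - k) - V z‖ₑ :=
      hVm2.comp (measurable_const.prodMk measurable_id)
    rw [e]
    calc ‖∫ k, κ k • (V (z - k) - V z) ∂μ‖ₑ ^ 2
        ≤ (∫⁻ k, ‖κ k‖ₑ * ‖V (z - k) - V z‖ₑ ∂μ) ^ 2 := by
          gcongr
          refine (enorm_integral_le_lintegral_enorm _).trans_eq ?_
          simp only [enorm_smul]
      _ = (∫⁻ k, ‖V (z - k) - V z‖ₑ ∂(μ.withDensity fun k => ‖κ k‖ₑ)) ^ 2 := by
          rw [lintegral_withDensity_eq_lintegral_mul _ hκm hz]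
          rfl
      _ ≤ (μ.withDensity fun k => ‖κ k‖ₑ) Set.univ *
          ∫⁻ k, ‖V (z - k) - V z‖ₑ ^ 2 ∂(μ.withDensity fun k => ‖κ k‖ₑ) :=
          sq_lintegral_le _ hz.aemeasurable
      _ = ∫⁻ k, ‖κ k‖ₑ * ‖V (z - k) - V z‖ₑ ^ 2 ∂μ := by
          rw [withDensity_apply _ MeasurableSet.univ, Measure.restrict_univ, hone, one_mul,
            lintegral_withDensity_eq_lintegral_mul _ hκm (hz.pow_const 2)]
          rfl
  rw [← ENNReal.pow_le_pow_left_iff two_ne_zero, eLpNorm_two_sq]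
  calc ∫⁻ z, ‖mollify μ κ V z - V z‖ₑ ^ 2 ∂μ
      ≤ ∫⁻ z, ∫⁻ k, ‖κ k‖ₑ * ‖V (z - k) - V z‖ₑ ^ 2 ∂μ ∂μ := lintegral_mono hpt
    _ = ∫⁻ k, ∫⁻ z, ‖κ k‖ₑ * ‖V (z - k) - V z‖ₑ ^ 2 ∂μ ∂μ :=
        lintegral_lintegral_swap
          ((hκm.comp measurable_snd).mul (hVm2.pow_const 2)).aemeasurable
    _ ≤ ∫⁻ k, ‖κ k‖ₑ * ε ^ 2 ∂μ := by
        refine lintegral_mono fun k => ?_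
        have hk : Measurable fun z => ‖V (z - k) - V z‖ₑ :=
          hVm2.comp (measurable_id.prodMk measurable_const)
        rw [lintegral_const_mul _ (hk.pow_const 2), ← eLpNorm_two_sq]
        by_cases hk : κ k = 0
        · simp [hk]
        · gcongr
          exact hε k hk
    _ = ε ^ 2 := by rw [lintegral_mul_const _ hκm, hone, one_mul]

end Mollify

/-! ### Density of test functions -/

/-- Mollifying kernels concentrated near the origin in the lower half-space. -/
theorem exists_lower_kernel (N : ℕ) {δ : ℝ} (hδ : 0 < δ) :
    ∃ κ : Pt N → ℝ, ContDiff ℝ ∞ κ ∧ HasCompactSupport κ ∧ (∀ k, 0 ≤ κ k) ∧ ∫ k, κ k = 1 ∧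
      Function.support κ ⊆ Metric.ball 0 δ ∧ tsupport κ ⊆ {k | k.2 < 0} := by
  let f : ContDiffBump ((0, -(δ / 2)) : Pt N) := ⟨δ / 6, δ / 3, by positivity, by linarith⟩
  refine ⟨f.normed volume, f.contDiff_normed, f.hasCompactSupport_normed, f.nonneg_normed,
    f.integral_normed, ?_, ?_⟩
  · rw [f.support_normed_eq]
    intro k hk
    simp only [Metric.mem_ball, Prod.dist_eq, max_lt_iff, Prod.fst_zero, Prod.snd_zero,
      Real.dist_eq, abs_lt, f] at hk ⊢
    refine ⟨by linarith, ?_, ?_⟩ <;> linarith [hk.2.1, hk.2.2]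
  · rw [f.tsupport_normed_eq]
    intro k hk
    simp only [Metric.mem_closedBall, Prod.dist_eq, sup_le_iff, Real.dist_eq, abs_le, f] at hk
    simp only [Set.mem_ofPred_eq]
    linarith [hk.2.2]

/-- Averaging over translations into the half-space: since the kernel lives in `y < 0`, the value at
`z` only involves `v(z - k)` with `z - k` above `z`. The mollification of the extension of `v` by
zero is smooth everywhere, and at interior points it does not see the jump across the boundary. -/
theorem isWeakGradient_mollify {N : ℕ} {v : Lp ℝ 2 (halfMeasure N)}
    {g : Lp (Vec N) 2 (halfMeasure N)} (h : IsWeakGradient v g) {κ : Pt N → ℝ}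
    (hκ : ContDiff ℝ ∞ κ) (hκc : HasCompactSupport κ) (hκs : tsupport κ ⊆ {k | k.2 < 0}) :
    ContDiff ℝ ∞ (mollify volume κ ((halfSpace N).indicator v)) ∧ ∀ z ∈ halfSpace N,
      gradVec (mollify volume κ ((halfSpace N).indicator v)) z =
        mollify volume κ ((halfSpace N).indicator g) z := by
  have hS : MeasurableSet (halfSpace N) := (isOpen_halfSpace N).measurableSet
  have hV : MemLp ((halfSpace N).indicator v) 2 volume :=
    (memLp_indicator_iff_restrict hS).2 (Lp.memLp v)
  have hG : MemLp ((halfSpace N).indicator g) 2 volume :=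
    (memLp_indicator_iff_restrict hS).2 (Lp.memLp g)
  have hloc : LocallyIntegrable ((halfSpace N).indicator v) volume :=
    hV.locallyIntegrable (by norm_num)
  refine ⟨hκc.contDiff_convolution_left (ContinuousLinearMap.lsmul ℝ ℝ) hκ hloc, ?_⟩
  intro z hz
  refine gradVec_unique fun w => ?_
  have hd := hκc.hasFDerivAt_convolution_left (ContinuousLinearMap.lsmul ℝ ℝ)
    (hκ.of_le (by simp)) hloc z
  have hd' : fderiv ℝ (mollify volume κ ((halfSpace N).indicator v)) z = _ := hd.fderiv
  have hex : ConvolutionExistsAt (fderiv ℝ κ) ((halfSpace N).indicator v) z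
      ((ContinuousLinearMap.lsmul ℝ ℝ).precompL (Pt N)) volume :=
    (hκc.fderiv ℝ).convolutionExists_left _ (hκ.continuous_fderiv (by simp)) hloc z
  have hdw : fderiv ℝ (mollify volume κ ((halfSpace N).indicator v)) z w =
      ∫ t in halfSpace N, v t * fderiv ℝ κ (z - t) w := by
    rw [hd', convolution_def, ContinuousLinearMap.integral_apply hex, ← integral_indicator hS,
      ← integral_sub_left_eq_self _ volume z]
    congr 1
    funext t
    rw [sub_sub_cancel]
    by_cases ht : t ∈ halfSpace N
    · simp [ht, ContinuousLinearMap.precompL_apply, mul_comm]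
    · simp [ht]
  -- The reflected and translated kernel is a test function in the open half-space.
  let φ : Pt N → ℝ := fun t => κ (z - t)
  have hφ : ContDiff ℝ ∞ φ := hκ.comp (contDiff_const.sub contDiff_id)
  have hφc : HasCompactSupport φ := hκc.comp_homeomorph (Homeomorph.subLeft z)
  have hφs : tsupport φ ⊆ halfSpace N := by
    intro t ht
    have h1 : z - t ∈ tsupport κ := tsupport_comp_subset_preimage κ
      (f := fun t => z - t) (by fun_prop) ht
    have h2 : z.2 - t.2 < 0 := hκs h1
    have h3 : 0 < z.2 := hz
    exact (by linarith : 0 < t.2)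
  have hφd : ∀ t, fderiv ℝ φ t w = -fderiv ℝ κ (z - t) w := by
    intro t
    have h1 : HasFDerivAt φ _ t := (hκ.differentiable (by simp) (z - t)).hasFDerivAt.comp t
      ((hasFDerivAt_id t).const_sub z)
    rw [h1.fderiv]
    simp
  have hw := h φ hφ hφc hφs w
  simp only [hφd, mul_neg, integral_neg, neg_inj] at hw
  rw [hdw, hw]
  have hint : Integrable (fun k => κ k • (halfSpace N).indicator g (z - k)) volume := by
    have h1 : LocallyIntegrable (fun k => (halfSpace N).indicator g (z - k)) volume :=
      (hG.comp_measurePreserving (volume.measurePreserving_sub_left z)).locallyIntegrable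
        (by norm_num)
    exact h1.integrable_smul_left_of_hasCompactSupport hκ.continuous hκc
  rw [mollify, real_inner_comm, ← integral_inner hint, ← integral_indicator hS,
    ← integral_sub_left_eq_self _ volume z]
  congr 1
  funext t
  rw [sub_sub_cancel]
  by_cases ht : t ∈ halfSpace N
  · simp only [ht, Set.indicator_of_mem, real_inner_smul_right, φ]
    rw [real_inner_comm, mul_comm]
  · simp [ht]

/-- Dominated convergence in `L²`. -/
theorem tendsto_eLpNorm_two_zero {α F : Type*} [MeasurableSpace α] {μ : Measure α}
    [NormedAddCommGroup F] {f : ℕ → α → F} {g : α → ℝ} (hg : MemLp g 2 μ)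
    (hf : ∀ n, AEStronglyMeasurable (f n) μ) (hfg : ∀ n a, ‖f n a‖ ≤ g a)
    (hlim : ∀ a, Tendsto (fun n => f n a) atTop (𝓝 0)) :
    Tendsto (fun n => eLpNorm (f n) 2 μ) atTop (𝓝 0) := by
  have h : Tendsto (fun n => ∫⁻ a, ‖f n a‖ₑ ^ 2 ∂μ) atTop (𝓝 (∫⁻ _, 0 ∂μ)) := by
    refine tendsto_lintegral_of_dominated_convergence' (fun a => ‖g a‖ₑ ^ 2)
      (fun n => (hf n).enorm.pow_const 2) (fun n => ae_of_all _ fun a => ?_) ?_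
      (ae_of_all _ fun a => ?_)
    · exact pow_le_pow_left' (enorm_le_iff_norm_le.2 ((hfg n a).trans (le_abs_self _))) 2
    · rw [← eLpNorm_two_sq]
      exact ENNReal.pow_ne_top hg.eLpNorm_ne_top
    · have := ENNReal.Tendsto.pow (n := 2) (hlim a).enorm
      simpa using this
  simp only [← eLpNorm_two_sq, lintegral_zero] at h
  have h2 := h.ennrpow_const (1 / 2 : ℝ)
  have h3 : ∀ x : ℝ≥0∞, (x ^ 2) ^ (1 / 2 : ℝ) = x := fun x => by
    rw [← ENNReal.rpow_natCast, ← ENNReal.rpow_mul]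
    norm_num
  simpa only [h3, ENNReal.zero_rpow_of_pos one_half_pos] using h2

/-- Cutoff: a smooth function with square-integrable value and gradient is approximated by its
products with dilations of a fixed bump function. -/
theorem exists_test_approx {N : ℕ} {u : Pt N → ℝ} (hu : ContDiff ℝ ∞ u)
    (hu2 : MemLp u 2 (halfMeasure N)) (hg2 : MemLp (gradVec u) 2 (halfMeasure N)) {ε : ℝ≥0∞}
    (hε : 0 < ε) :
    ∃ φ : testFunctions N, eLpNorm ((φ : Pt N → ℝ) - u) 2 (halfMeasure N) ≤ ε ∧
      eLpNorm (gradVec (φ : Pt N → ℝ) - gradVec u) 2 (halfMeasure N) ≤ ε := by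
  let f : ContDiffBump (0 : Pt N) := ⟨1, 2, one_pos, one_lt_two⟩
  have hf : ContDiff ℝ ∞ f := f.contDiff
  let s : ℕ → ℝ := fun n => ((n : ℝ) + 1)⁻¹
  have hs0 : ∀ n, 0 < s n := fun n => by positivity
  have hs1 : ∀ n, s n ≤ 1 := fun n => inv_le_one_of_one_le₀ (by simp)
  have hslim : Tendsto s atTop (𝓝 0) := by
    simpa [s, one_div] using tendsto_one_div_add_atTop_nhds_zero_nat (𝕜 := ℝ)
  let χ : ℕ → Pt N → ℝ := fun n z => f (s n • z)
  have hχ : ∀ n, ContDiff ℝ ∞ (χ n) := fun n => hf.comp (contDiff_const_smul (s n))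
  have hχc : ∀ n, HasCompactSupport (χ n) := fun n => f.hasCompactSupport.comp_smul (hs0 n).ne'
  have hgχ : ∀ n z, gradVec (χ n) z = s n • gradVec f (s n • z) := by
    intro n z
    refine gradVec_unique fun w => ?_
    have h1 : HasFDerivAt (χ n) _ z :=
      (hf.differentiable (by simp) (s n • z)).hasFDerivAt.comp z
        ((hasFDerivAt_id z).const_smul (s n))
    rw [h1.fderiv, real_inner_smul_left, inner_gradVec]
    simp
  obtain ⟨C, hC⟩ := (hasCompactSupport_gradVec f.hasCompactSupport).exists_bound_of_continuous
    (continuous_gradVec (hf.of_le (by simp)))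
  let φ : ℕ → testFunctions N := fun n =>
    ⟨fun z => χ n z * u z, (hχ n).mul hu, (hχc n).mul_right⟩
  have hgφ : ∀ n z, gradVec (φ n : Pt N → ℝ) z = χ n z • gradVec u z + u z • gradVec (χ n) z :=
    fun n z => gradVec_mul ((hχ n).differentiable (by simp) z) (hu.differentiable (by simp) z)
  have hχ1 : ∀ z, Tendsto (fun n => χ n z) atTop (𝓝 1) := by
    intro z
    have : Tendsto (fun n => f (s n • z)) atTop (𝓝 (f ((0 : ℝ) • z))) :=
      (hf.continuous.tendsto _).comp (hslim.smul_const z)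
    rw [zero_smul] at this
    rwa [f.one_of_mem_closedBall (by simp [f])] at this
  have hχb : ∀ n z, |χ n z - 1| ≤ 1 := fun n z => by
    rw [abs_le]
    constructor <;> linarith [f.nonneg' (s n • z), f.le_one (x := s n • z)]
  have h1 : Tendsto (fun n => eLpNorm ((φ n : Pt N → ℝ) - u) 2 (halfMeasure N)) atTop (𝓝 0) := by
    refine tendsto_eLpNorm_two_zero hu2.norm (fun n => ?_) (fun n z => ?_) fun z => ?_
    · exact ((φ n).2.1.continuous.sub hu.continuous).aestronglyMeasurable
    · have : ((φ n : Pt N → ℝ) - u) z = (χ n z - 1) * u z := by simp [φ]; ring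
      rw [this, norm_mul]
      exact mul_le_of_le_one_left (norm_nonneg _) (hχb n z)
    · have := ((hχ1 z).mul_const (u z)).sub_const (u z)
      simpa using this
  have h2 : Tendsto (fun n => eLpNorm (gradVec (φ n : Pt N → ℝ) - gradVec u) 2 (halfMeasure N))
      atTop (𝓝 0) := by
    have e : ∀ n z, (gradVec (φ n : Pt N → ℝ) - gradVec u) z =
        (χ n z - 1) • gradVec u z + u z • s n • gradVec f (s n • z) := by
      intro n z
      rw [Pi.sub_apply, hgφ, hgχ, sub_smul, one_smul]
      abel
    refine tendsto_eLpNorm_two_zero (hg2.norm.add (hu2.norm.const_mul C)) (fun n => ?_)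
      (fun n z => ?_) fun z => ?_
    · exact ((continuous_gradVec (testFunctions.contDiff_one (φ n))).sub
        (continuous_gradVec (hu.of_le (by simp)))).aestronglyMeasurable
    · rw [e]
      refine (norm_add_le _ _).trans (add_le_add ?_ ?_)
      · rw [norm_smul]
        exact mul_le_of_le_one_left (norm_nonneg _) (hχb n z)
      · rw [norm_smul, norm_smul]
        change _ ≤ C * ‖u z‖
        rw [mul_comm C]
        refine mul_le_mul_of_nonneg_left ?_ (norm_nonneg _)
        rw [Real.norm_of_nonneg (hs0 n).le]
        exact (mul_le_of_le_one_left (norm_nonneg _) (hs1 n)).trans (hC _)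
    · simp only [e]
      have t1 : Tendsto (fun n => (χ n z - 1) • gradVec u z) atTop (𝓝 0) := by
        simpa using ((hχ1 z).sub_const 1).smul_const (gradVec u z)
      have t2 : Tendsto (fun n => s n • gradVec f (s n • z)) atTop (𝓝 0) := by
        have hc : Tendsto (fun n => gradVec f (s n • z)) atTop (𝓝 (gradVec f ((0 : ℝ) • z))) :=
          ((continuous_gradVec (hf.of_le (by simp))).tendsto _).comp (hslim.smul_const z)
        simpa using hslim.smul hc
      simpa using t1.add (t2.const_smul (u z))
  obtain ⟨n, hn1, hn2⟩ := ((h1.eventually_le_const hε).and (h2.eventually_le_const hε)).exists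
  exact ⟨φ n, hn1, hn2⟩

/-- Functions in `H¹` of the half-space are approximated by functions smooth on the whole space. -/
theorem exists_smooth_approx {N : ℕ} (v : SobolevH1 N) {ε : ℝ≥0∞} (hε : 0 < ε) :
    ∃ u : Pt N → ℝ, ContDiff ℝ ∞ u ∧
      eLpNorm (u - ⇑(SobolevH1.toL2 N v)) 2 (halfMeasure N) ≤ ε ∧
      eLpNorm (gradVec u - ⇑(SobolevH1.grad N v)) 2 (halfMeasure N) ≤ ε := by
  have hS : MeasurableSet (halfSpace N) := (isOpen_halfSpace N).measurableSet
  have hV : MemLp ((halfSpace N).indicator (SobolevH1.toL2 N v)) 2 volume :=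
    (memLp_indicator_iff_restrict hS).2 (Lp.memLp _)
  have hG : MemLp ((halfSpace N).indicator (SobolevH1.grad N v)) 2 volume :=
    (memLp_indicator_iff_restrict hS).2 (Lp.memLp _)
  obtain ⟨δ, hδ, hball⟩ := Metric.eventually_nhds_iff_ball.1
    (((tendsto_eLpNorm_translate_sub volume hV).eventually_le_const hε).and
      ((tendsto_eLpNorm_translate_sub volume hG).eventually_le_const hε))
  obtain ⟨κ, hκ, hκc, hκ0, hκ1, hκb, hκs⟩ := exists_lower_kernel N hδ
  obtain ⟨hu, hgu⟩ := isWeakGradient_mollify v.isWeakGradient_grad hκ hκc hκs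
  refine ⟨_, hu, ?_, ?_⟩
  · refine le_trans (le_trans (le_of_eq ?_) (eLpNorm_restrict_le _ _ _ (halfSpace N)))
      (eLpNorm_mollify_sub_le hκ.continuous hκ0 hκc hκ1 hV
        ((Lp.stronglyMeasurable _).indicator hS) fun k hk => (hball k (hκb hk)).1)
    refine eLpNorm_congr_ae ?_
    filter_upwards [ae_restrict_mem hS] with z hz
    simp [hz]
  · refine le_trans (le_trans (le_of_eq ?_) (eLpNorm_restrict_le _ _ _ (halfSpace N)))
      (eLpNorm_mollify_sub_le hκ.continuous hκ0 hκc hκ1 hG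
        ((Lp.stronglyMeasurable _).indicator hS) fun k hk => (hball k (hκb hk)).2)
    refine eLpNorm_congr_ae ?_
    filter_upwards [ae_restrict_mem hS] with z hz
    simp [hz, hgu z hz]

/-- Restrictions of functions in `C_c^∞(ℝ^{N+1})` are dense in `H¹(ℝ^{N+1}_+)`. -/
theorem denseRange_ofTest (N : ℕ) : DenseRange (ofTest N) := by
  rw [Metric.denseRange_iff]
  intro v r hr
  have hε : 0 < ENNReal.ofReal (r / 5) := ENNReal.ofReal_pos.2 (by positivity)
  obtain ⟨u, hu, hu1, hu2⟩ := exists_smooth_approx v hε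
  have hm1 : AEStronglyMeasurable (u - ⇑(SobolevH1.toL2 N v)) (halfMeasure N) :=
    hu.continuous.aestronglyMeasurable.sub (Lp.aestronglyMeasurable _)
  have hm2 : AEStronglyMeasurable (gradVec u - ⇑(SobolevH1.grad N v)) (halfMeasure N) :=
    (continuous_gradVec (hu.of_le (by simp))).aestronglyMeasurable.sub (Lp.aestronglyMeasurable _)
  have hL1 : MemLp (u - ⇑(SobolevH1.toL2 N v)) 2 (halfMeasure N) :=
    ⟨hm1, hu1.trans_lt ENNReal.ofReal_lt_top⟩
  have hL2 : MemLp (gradVec u - ⇑(SobolevH1.grad N v)) 2 (halfMeasure N) :=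
    ⟨hm2, hu2.trans_lt ENNReal.ofReal_lt_top⟩
  have hM1 : MemLp u 2 (halfMeasure N) := by
    simpa using hL1.add (Lp.memLp (SobolevH1.toL2 N v))
  have hM2 : MemLp (gradVec u) 2 (halfMeasure N) := by
    simpa using hL2.add (Lp.memLp (SobolevH1.grad N v))
  obtain ⟨φ, hφ1, hφ2⟩ := exists_test_approx hu hM1 hM2 hε
  refine ⟨φ, ?_⟩
  rw [dist_comm, dist_eq_norm]
  have e1 : ‖SobolevH1.toL2 N (ofTest N φ - v)‖ ≤ r / 5 + r / 5 := by
    rw [map_sub, toL2_ofTest, Lp.norm_def]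
    refine ENNReal.toReal_le_of_le_ofReal (by positivity) ?_
    rw [ENNReal.ofReal_add (by positivity) (by positivity)]
    refine le_trans (le_of_eq (eLpNorm_congr_ae ?_)) ((eLpNorm_add_le
      ((φ.2.1.continuous.sub hu.continuous).aestronglyMeasurable) hm1 (by norm_num)).trans
      (add_le_add hφ1 hu1))
    filter_upwards [Lp.coeFn_sub ((testFunctions.memLp φ).toLp _) (SobolevH1.toL2 N v),
      (testFunctions.memLp φ).coeFn_toLp] with z h1 h2
    rw [h1, Pi.sub_apply, h2]
    simp
  have e2 : ‖SobolevH1.grad N (ofTest N φ - v)‖ ≤ r / 5 + r / 5 := by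
    rw [map_sub, grad_ofTest, Lp.norm_def]
    refine ENNReal.toReal_le_of_le_ofReal (by positivity) ?_
    rw [ENNReal.ofReal_add (by positivity) (by positivity)]
    refine le_trans (le_of_eq (eLpNorm_congr_ae ?_)) ((eLpNorm_add_le
      (((continuous_gradVec (testFunctions.contDiff_one φ)).sub
        (continuous_gradVec (hu.of_le (by simp)))).aestronglyMeasurable) hm2 (by norm_num)).trans
      (add_le_add hφ2 hu2))
    filter_upwards [Lp.coeFn_sub ((testFunctions.memLp_gradVec φ).toLp _) (SobolevH1.grad N v),
      (testFunctions.memLp_gradVec φ).coeFn_toLp] with z h1 h2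
    rw [h1, Pi.sub_apply, h2]
    simp
  linarith [SobolevH1.norm_le_add (ofTest N φ - v)]

/-! ### Fundamental theorem of calculus estimates -/

theorem lintegral_mul_enorm_le {α F F' : Type*} [MeasurableSpace α] [NormedAddCommGroup F]
    [NormedAddCommGroup F'] (μ : Measure α) {f : α → F} {g : α → F'}
    (hf : AEStronglyMeasurable f μ) (hg : AEStronglyMeasurable g μ) :
    ∫⁻ a, ‖f a‖ₑ * ‖g a‖ₑ ∂μ ≤ eLpNorm f 2 μ * eLpNorm g 2 μ := by
  rw [← ENNReal.pow_le_pow_left_iff two_ne_zero, mul_pow, eLpNorm_two_sq, eLpNorm_two_sq]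
  exact sq_lintegral_mul_le μ hf.enorm hg.enorm

/-- The value at `0` is minus the integral over `(0, ∞)` of the derivative of `|f|^r`. -/
theorem enorm_rpow_le_lintegral_deriv {f : ℝ → ℝ} (hf : ContDiff ℝ 1 f) (hc : HasCompactSupport f)
    {r : ℝ} (hr : 1 < r) :
    ‖f 0‖ₑ ^ r ≤ ENNReal.ofReal r * ∫⁻ y in Set.Ioi 0, ‖f y‖ₑ ^ (r - 1) * ‖deriv f y‖ₑ := by
  have h1 : ContDiff ℝ 1 fun y => ‖f y‖ ^ r := hf.norm_rpow hr
  have h2 : HasCompactSupport fun y => ‖f y‖ ^ r :=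
    hc.comp_left (g := fun t : ℝ => ‖t‖ ^ r) (by simp [(one_pos.trans hr).ne'])
  have h3 := h2.integral_Ioi_deriv_eq h1 0
  have h4 : ‖f 0‖ₑ ^ r = ‖-‖f 0‖ ^ r‖ₑ := by
    rw [enorm_neg, Real.enorm_of_nonneg (Real.rpow_nonneg (norm_nonneg (f 0)) r),
      ← ENNReal.ofReal_rpow_of_nonneg (norm_nonneg _) (by linarith), ofReal_norm]
  rw [h4, ← h3, ← lintegral_const_mul' _ _ ENNReal.ofReal_ne_top]
  refine (enorm_integral_le_lintegral_enorm _).trans (lintegral_mono fun y => ?_)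
  have h5 := norm_fderiv_norm_rpow_le (hf.differentiable one_ne_zero) (x := y) hr
  rw [← norm_deriv_eq_norm_fderiv, ← norm_deriv_eq_norm_fderiv] at h5
  have hr0 : 0 ≤ r := by linarith
  calc ‖deriv (fun y => ‖f y‖ ^ r) y‖ₑ
      = ENNReal.ofReal ‖deriv (fun y => ‖f y‖ ^ r) y‖ := (ofReal_norm _).symm
    _ ≤ ENNReal.ofReal (r * ‖f y‖ ^ (r - 1) * ‖deriv f y‖) := ENNReal.ofReal_le_ofReal h5
    _ = _ := by
      rw [mul_assoc, ENNReal.ofReal_mul hr0, ENNReal.ofReal_mul (by positivity),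
        ← ENNReal.ofReal_rpow_of_nonneg (norm_nonneg _) (by linarith), ofReal_norm, ofReal_norm]

theorem halfMeasure_eq_prod (N : ℕ) :
    halfMeasure N = (volume : Measure (EuclideanSpace ℝ (Fin N))).prod
      (volume.restrict (Set.Ioi (0 : ℝ))) := by
  have h : halfSpace N = Set.univ ×ˢ Set.Ioi (0 : ℝ) := by
    ext z
    simp [halfSpace]
  rw [halfMeasure, h, Measure.volume_eq_prod, ← Measure.prod_restrict, Measure.restrict_univ]

theorem halfMeasure_restrict_fst (N : ℕ) (A : Set (EuclideanSpace ℝ (Fin N))) :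
    (halfMeasure N).restrict (Prod.fst ⁻¹' A) =
      ((volume : Measure (EuclideanSpace ℝ (Fin N))).restrict A).prod
      (volume.restrict (Set.Ioi (0 : ℝ))) := by
  rw [halfMeasure_eq_prod, ← Set.prod_univ, ← Measure.prod_restrict, Measure.restrict_univ]

theorem norm_fderiv_normal_le {N : ℕ} (φ : Pt N → ℝ) (z : Pt N) :
    ‖fderiv ℝ φ z (0, 1)‖ ≤ ‖gradVec φ z‖ := by
  refine (abs_fderiv_le_norm_gradVec φ z (0, 1)).trans_eq ?_
  rw [WithLp.prod_norm_eq_of_L2]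
  simp

/-- The fundamental theorem of calculus along the normal direction, integrated over boundary
points in `A`. -/
theorem lintegral_boundary_rpow_le {N : ℕ} (φ : testFunctions N)
    (A : Set (EuclideanSpace ℝ (Fin N))) {r : ℝ} (hr : 1 < r) :
    ∫⁻ x in A, ‖(φ : Pt N → ℝ) (x, 0)‖ₑ ^ r ≤ ENNReal.ofReal r *
      ∫⁻ z, ‖(φ : Pt N → ℝ) z‖ₑ ^ (r - 1) * ‖gradVec (φ : Pt N → ℝ) z‖ₑ
        ∂((halfMeasure N).restrict (Prod.fst ⁻¹' A)) := by
  obtain ⟨φ, hφ, hc⟩ := φ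
  have hφ1 : ContDiff ℝ 1 φ := hφ.of_le (by simp)
  have hm : Measurable fun z => ‖φ z‖ₑ ^ (r - 1) * ‖gradVec φ z‖ₑ :=
    (hφ.continuous.measurable.enorm.pow_const _).mul (continuous_gradVec hφ1).measurable.enorm
  rw [halfMeasure_restrict_fst, lintegral_prod _ hm.aemeasurable,
    ← lintegral_const_mul' _ _ ENNReal.ofReal_ne_top]
  refine lintegral_mono fun x => ?_
  have hx : ContDiff ℝ 1 fun y : ℝ => φ (x, y) := hφ1.comp (by fun_prop)
  have hxc : HasCompactSupport fun y : ℝ => φ (x, y) :=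
    hc.comp_isClosedEmbedding (g := fun y : ℝ => (x, y))
      (Topology.IsClosedEmbedding.of_continuous_injective_isClosedMap (by fun_prop)
        (Prod.mk_right_injective x) (isClosedMap_prodMk_left x))
  refine (enorm_rpow_le_lintegral_deriv hx hxc hr).trans ?_
  gcongr with y
  have hd : deriv (fun y : ℝ => φ (x, y)) y = fderiv ℝ φ (x, y) (0, 1) := by
    have h1 : HasFDerivAt φ (fderiv ℝ φ (x, y)) (x, y) :=
      (hφ1.differentiable one_ne_zero _).hasFDerivAt
    have h2 : HasDerivAt (fun y : ℝ => (x, y)) ((0 : EuclideanSpace ℝ (Fin N)), (1 : ℝ)) y :=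
      (hasDerivAt_const y x).prodMk (hasDerivAt_id y)
    exact (h1.comp_hasDerivAt y h2).deriv
  rw [hd]
  exact enorm_le_iff_norm_le.2 (norm_fderiv_normal_le φ _)

/-- The `L²` trace inequality, localized over boundary points in `A`. -/
theorem eLpNorm_boundary_sq_le {N : ℕ} (φ : testFunctions N)
    (A : Set (EuclideanSpace ℝ (Fin N))) :
    eLpNorm (fun x => (φ : Pt N → ℝ) (x, 0)) 2 (volume.restrict A) ^ 2 ≤
      2 * (eLpNorm (φ : Pt N → ℝ) 2 ((halfMeasure N).restrict (Prod.fst ⁻¹' A)) *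
        eLpNorm (gradVec (φ : Pt N → ℝ)) 2 (halfMeasure N)) := by
  have h := lintegral_boundary_rpow_le φ A (r := 2) one_lt_two
  norm_num at h
  rw [eLpNorm_two_sq]
  refine h.trans ?_
  gcongr
  refine (lintegral_mul_enorm_le _ φ.2.1.continuous.aestronglyMeasurable
    (continuous_gradVec (testFunctions.contDiff_one φ)).aestronglyMeasurable).trans ?_
  gcongr
  exact Measure.restrict_le_self

/-- Translation by `k` along the boundary. -/
def tangentialShift {N : ℕ} (k : EuclideanSpace ℝ (Fin N)) (z : Pt N) : Pt N := z + (k, 0)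

theorem measurePreserving_tangentialShift {N : ℕ} (k : EuclideanSpace ℝ (Fin N)) :
    MeasurePreserving (tangentialShift k) (halfMeasure N) (halfMeasure N) := by
  have h := (measurePreserving_add_right (volume : Measure (Pt N)) (k, 0)).restrict_preimage
    (isOpen_halfSpace N).measurableSet
  have e : (fun z : Pt N => z + (k, 0)) ⁻¹' halfSpace N = halfSpace N := by
    ext z
    simp [halfSpace]
  rwa [e] at h

/-- The translation of a test function along the boundary. -/
def testFunctions.shift {N : ℕ} (φ : testFunctions N) (k : EuclideanSpace ℝ (Fin N)) :
    testFunctions N :=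
  ⟨fun z => (φ : Pt N → ℝ) (tangentialShift k z), φ.2.1.comp (contDiff_id.add contDiff_const),
    φ.2.2.comp_homeomorph (Homeomorph.addRight ((k, 0) : Pt N))⟩

theorem gradVec_shift {N : ℕ} (φ : testFunctions N) (k : EuclideanSpace ℝ (Fin N)) (z : Pt N) :
    gradVec (testFunctions.shift φ k : Pt N → ℝ) z =
      gradVec (φ : Pt N → ℝ) (tangentialShift k z) := by
  refine gradVec_unique fun w => ?_
  rw [inner_gradVec]
  exact congrArg (fun L => L w)
    (fderiv_comp_add_right (𝕜 := ℝ) (f := (φ : Pt N → ℝ)) (x := z) (k, 0)).symm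

/-- The difference along the boundary is the integral of the derivative over the segment. -/
theorem enorm_tangentialShift_sub_le {N : ℕ} {φ : Pt N → ℝ} (hφ : ContDiff ℝ 1 φ)
    (k : EuclideanSpace ℝ (Fin N)) (z : Pt N) :
    ‖φ (tangentialShift k z) - φ z‖ₑ ≤
      ‖k‖ₑ * ∫⁻ t in Set.Ioc (0 : ℝ) 1, ‖gradVec φ (tangentialShift (t • k) z)‖ₑ := by
  let w : Pt N := (k, 0)
  have hw : ‖WithLp.toLp 2 w‖ = ‖k‖ := by
    rw [WithLp.prod_norm_eq_of_L2]
    simp [w]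
  have hsh : ∀ t : ℝ, tangentialShift (t • k) z = z + t • w := fun t => by
    simp [tangentialShift, w]
  have hd : ∀ t : ℝ, HasDerivAt (fun t : ℝ => φ (z + t • w)) (fderiv ℝ φ (z + t • w) w) t := by
    intro t
    have h1 := (hφ.differentiable one_ne_zero (z + t • w)).hasFDerivAt
    have h2 : HasDerivAt (fun t : ℝ => z + t • w) ((1 : ℝ) • w) t :=
      ((hasDerivAt_id t).smul_const _).const_add z
    rw [one_smul] at h2
    exact h1.comp_hasDerivAt t h2
  have hcont : Continuous fun t : ℝ => fderiv ℝ φ (z + t • w) w :=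
    ((hφ.continuous_fderiv one_ne_zero).comp (by fun_prop)).clm_apply continuous_const
  have hftc := intervalIntegral.integral_eq_sub_of_hasDerivAt (a := 0) (b := 1)
    (fun t _ => hd t) (hcont.intervalIntegrable _ _)
  have e : φ (tangentialShift k z) - φ z = ∫ t in Set.Ioc (0 : ℝ) 1, fderiv ℝ φ (z + t • w) w := by
    rw [← intervalIntegral.integral_of_le zero_le_one, hftc, zero_smul, one_smul, add_zero]
    rfl
  rw [e, ← lintegral_const_mul' _ _ enorm_ne_top]
  refine (enorm_integral_le_lintegral_enorm _).trans (lintegral_mono fun t => ?_)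
  have h1 := abs_fderiv_le_norm_gradVec φ (z + t • w) w
  rw [hsh, ← enorm_norm k, ← enorm_norm (gradVec φ _), ← enorm_mul]
  refine enorm_le_iff_norm_le.2 ?_
  rw [hw, mul_comm] at h1
  exact h1.trans (le_abs_self _)

/-- Tangential difference quotients are bounded by the gradient. -/
theorem eLpNorm_shift_sub_le {N : ℕ} (φ : testFunctions N) (k : EuclideanSpace ℝ (Fin N)) :
    eLpNorm (fun z => (φ : Pt N → ℝ) (tangentialShift k z) - (φ : Pt N → ℝ) z) 2 (halfMeasure N) ≤
      ‖k‖ₑ * eLpNorm (gradVec (φ : Pt N → ℝ)) 2 (halfMeasure N) := by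
  have hφ := testFunctions.contDiff_one φ
  have hgm : Measurable (gradVec (φ : Pt N → ℝ)) := (continuous_gradVec hφ).measurable
  have hm : Measurable fun p : Pt N × ℝ =>
      ‖gradVec (φ : Pt N → ℝ) (tangentialShift (p.2 • k) p.1)‖ₑ := by
    have hs : Measurable fun p : Pt N × ℝ => tangentialShift (p.2 • k) p.1 := by
      unfold tangentialShift
      fun_prop
    exact (hgm.comp hs).enorm
  have hpt : ∀ z, ‖(φ : Pt N → ℝ) (tangentialShift k z) - (φ : Pt N → ℝ) z‖ₑ ^ 2 ≤
      ‖k‖ₑ ^ 2 * ∫⁻ t in Set.Ioc (0 : ℝ) 1,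
        ‖gradVec (φ : Pt N → ℝ) (tangentialShift (t • k) z)‖ₑ ^ 2 := by
    intro z
    have hmz : Measurable fun t : ℝ => ‖gradVec (φ : Pt N → ℝ) (tangentialShift (t • k) z)‖ₑ := by
      have hs : Measurable fun t : ℝ => tangentialShift (t • k) z := by
        unfold tangentialShift
        fun_prop
      exact (hgm.comp hs).enorm
    refine (pow_le_pow_left' (enorm_tangentialShift_sub_le hφ k z) 2).trans ?_
    rw [mul_pow]
    refine mul_le_mul_right ((sq_lintegral_le _ hmz.aemeasurable).trans_eq ?_) _
    simp
  rw [← ENNReal.pow_le_pow_left_iff two_ne_zero, mul_pow, eLpNorm_two_sq]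
  calc ∫⁻ z, ‖(φ : Pt N → ℝ) (tangentialShift k z) - (φ : Pt N → ℝ) z‖ₑ ^ 2 ∂(halfMeasure N)
      ≤ ∫⁻ z, ‖k‖ₑ ^ 2 * (∫⁻ t in Set.Ioc (0 : ℝ) 1,
        ‖gradVec (φ : Pt N → ℝ) (tangentialShift (t • k) z)‖ₑ ^ 2) ∂(halfMeasure N) :=
        lintegral_mono hpt
    _ = ‖k‖ₑ ^ 2 * ∫⁻ t in Set.Ioc (0 : ℝ) 1, ∫⁻ z,
        ‖gradVec (φ : Pt N → ℝ) (tangentialShift (t • k) z)‖ₑ ^ 2 ∂(halfMeasure N) := by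
        rw [lintegral_const_mul' _ _ (by finiteness),
          lintegral_lintegral_swap (hm.pow_const 2).aemeasurable]
    _ = ‖k‖ₑ ^ 2 * eLpNorm (gradVec (φ : Pt N → ℝ)) 2 (halfMeasure N) ^ 2 := by
        congr 1
        have h1 : ∀ t : ℝ, ∫⁻ z, ‖gradVec (φ : Pt N → ℝ) (tangentialShift (t • k) z)‖ₑ ^ 2
            ∂(halfMeasure N) = eLpNorm (gradVec (φ : Pt N → ℝ)) 2 (halfMeasure N) ^ 2 := by
          intro t
          rw [eLpNorm_two_sq]
          exact (measurePreserving_tangentialShift (t • k)).lintegral_comp (hgm.enorm.pow_const 2)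
        simp [h1]

/-- The trace inequality applied to a tangential difference, of which the function is of order
`‖k‖` in `L²` and the gradient is bounded. -/
theorem eLpNorm_boundary_shift_sub_sq_le {N : ℕ} (φ : testFunctions N)
    (k : EuclideanSpace ℝ (Fin N)) :
    eLpNorm (fun x => (φ : Pt N → ℝ) (x + k, 0) - (φ : Pt N → ℝ) (x, 0)) 2 volume ^ 2 ≤
      4 * ‖k‖ₑ * eLpNorm (gradVec (φ : Pt N → ℝ)) 2 (halfMeasure N) ^ 2 := by
  have h := eLpNorm_boundary_sq_le (testFunctions.shift φ k - φ) Set.univ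
  rw [Measure.restrict_univ, Set.preimage_univ, Measure.restrict_univ] at h
  have hgm : AEStronglyMeasurable (gradVec (φ : Pt N → ℝ)) (halfMeasure N) :=
    (continuous_gradVec (testFunctions.contDiff_one φ)).aestronglyMeasurable
  have hg : eLpNorm (gradVec ((testFunctions.shift φ k - φ : testFunctions N) : Pt N → ℝ)) 2
      (halfMeasure N) ≤ 2 * eLpNorm (gradVec (φ : Pt N → ℝ)) 2 (halfMeasure N) := by
    have e : gradVec ((testFunctions.shift φ k - φ : testFunctions N) : Pt N → ℝ) =
        (gradVec (φ : Pt N → ℝ) ∘ tangentialShift k) - gradVec (φ : Pt N → ℝ) := by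
      funext z
      refine gradVec_unique fun w => ?_
      rw [Pi.sub_apply, inner_sub_left, Function.comp_apply, ← gradVec_shift, inner_gradVec,
        inner_gradVec]
      exact congrArg (fun L => L w) (fderiv_sub (testFunctions.differentiable _ z)
        (testFunctions.differentiable φ z)).symm
    rw [e, two_mul]
    refine (eLpNorm_sub_le (hgm.comp_measurePreserving (measurePreserving_tangentialShift k)) hgm
      (by norm_num)).trans ?_
    rw [eLpNorm_comp_measurePreserving hgm (measurePreserving_tangentialShift k)]
  have e : (fun x : EuclideanSpace ℝ (Fin N) =>
      ((testFunctions.shift φ k - φ : testFunctions N) : Pt N → ℝ) (x, 0)) =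
      fun x => (φ : Pt N → ℝ) (x + k, 0) - (φ : Pt N → ℝ) (x, 0) := by
    funext x
    simp [testFunctions.shift, tangentialShift]
  rw [e] at h
  refine h.trans ?_
  calc 2 * (eLpNorm ((testFunctions.shift φ k - φ : testFunctions N) : Pt N → ℝ) 2 (halfMeasure N) *
        eLpNorm (gradVec ((testFunctions.shift φ k - φ : testFunctions N) : Pt N → ℝ)) 2
          (halfMeasure N))
      ≤ 2 * ((‖k‖ₑ * eLpNorm (gradVec (φ : Pt N → ℝ)) 2 (halfMeasure N)) *
        (2 * eLpNorm (gradVec (φ : Pt N → ℝ)) 2 (halfMeasure N))) := by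
        gcongr
        exact eLpNorm_shift_sub_le φ k
    _ = _ := by ring

/-! ### Sobolev inequality on the half-space and critical trace inequality -/

/-- The smooth approximation `(x, y) ↦ (x, √(y² + ε²))` of the folding map `(x, y) ↦ (x, |y|)`. -/
def smoothFold {N : ℕ} (ε : ℝ) (z : Pt N) : Pt N := (z.1, √(z.2 ^ 2 + ε ^ 2))

theorem contDiff_smoothFold {N : ℕ} {ε : ℝ} (hε : ε ≠ 0) :
    ContDiff ℝ ∞ (smoothFold ε : Pt N → Pt N) :=
  contDiff_fst.prodMk (((contDiff_snd.pow 2).add contDiff_const).sqrt fun z => by positivity)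

theorem norm_le_norm_smoothFold {N : ℕ} (ε : ℝ) (z : Pt N) : ‖z‖ ≤ ‖smoothFold ε z‖ := by
  rw [Prod.norm_def, Prod.norm_def]
  refine max_le_max le_rfl ?_
  simp only [smoothFold, Real.norm_eq_abs]
  rw [abs_of_nonneg (Real.sqrt_nonneg _), ← Real.sqrt_sq_eq_abs]
  exact Real.sqrt_le_sqrt (by nlinarith)

/-- The map `smoothFold ε` does not decrease norms, so preimages of bounded sets are bounded. -/
theorem hasCompactSupport_comp_smoothFold {N : ℕ} {F : Type*} [NormedAddCommGroup F]
    {φ : Pt N → F} (hc : HasCompactSupport φ) (ε : ℝ) :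
    HasCompactSupport fun z => φ (smoothFold ε z) := by
  obtain ⟨R, hR⟩ := hc.isCompact.isBounded.subset_closedBall (0 : Pt N)
  refine HasCompactSupport.of_support_subset_isCompact (isCompact_closedBall (0 : Pt N) R) ?_
  intro z hz
  have h := hR (subset_tsupport φ hz)
  rw [mem_closedBall_zero_iff] at h ⊢
  exact (norm_le_norm_smoothFold ε z).trans h

theorem norm_fderiv_smoothFold_le {N : ℕ} {ε : ℝ} (hε : ε ≠ 0) (z : Pt N) :
    ‖fderiv ℝ (smoothFold ε : Pt N → Pt N) z‖ ≤ 1 := by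
  have hs : 0 < z.2 ^ 2 + ε ^ 2 := by positivity
  have h1 : HasFDerivAt (fun z : Pt N => z.2 ^ 2 + ε ^ 2) _ z :=
    ((hasFDerivAt_snd (𝕜 := ℝ) (p := z)).pow 2).add_const (ε ^ 2)
  have h2 : HasFDerivAt (smoothFold ε : Pt N → Pt N) _ z :=
    hasFDerivAt_fst.prodMk (h1.sqrt hs.ne')
  rw [h2.fderiv]
  refine ContinuousLinearMap.opNorm_le_bound _ zero_le_one fun w => ?_
  rw [one_mul, Prod.norm_def, Prod.norm_def]
  refine max_le_max le_rfl ?_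
  have hq : 0 < √(z.2 ^ 2 + ε ^ 2) := Real.sqrt_pos.2 hs
  have hz : |z.2| ≤ √(z.2 ^ 2 + ε ^ 2) := by
    rw [← Real.sqrt_sq_eq_abs]
    exact Real.sqrt_le_sqrt (by nlinarith)
  simp only [ContinuousLinearMap.prod_apply, smul_apply,
    ContinuousLinearMap.coe_snd', smul_eq_mul, norm_mul, Real.norm_eq_abs]
  have : |1 / (2 * √(z.2 ^ 2 + ε ^ 2))| * |2 * z.2| ≤ 1 := by
    rw [← abs_mul, one_div_mul_eq_div, mul_div_mul_left _ _ two_ne_zero, abs_div, abs_of_pos hq]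
    exact (div_le_one hq).2 hz
  have e : (2 • z.2 ^ (2 - 1) : ℝ) = 2 * z.2 := by simp
  rw [e, ← mul_assoc]
  exact mul_le_of_le_one_left (abs_nonneg _) this

/-- The operator norm on the left refers to the maximum norm of the product `ℝ^N × ℝ`; the constant
`2` bounds the Euclidean norm by it. -/
theorem norm_fderiv_le_gradVec {N : ℕ} (φ : Pt N → ℝ) (z : Pt N) :
    ‖fderiv ℝ φ z‖ ≤ 2 * ‖gradVec φ z‖ := by
  refine ContinuousLinearMap.opNorm_le_bound _ (by positivity) fun w => ?_
  refine (abs_fderiv_le_norm_gradVec φ z w).trans ?_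
  have h : ‖WithLp.toLp 2 w‖ ≤ 2 * ‖w‖ := by
    rw [WithLp.prod_norm_eq_of_L2]
    refine Real.sqrt_le_iff.2 ⟨by positivity, ?_⟩
    have h1 : ‖w.1‖ ≤ ‖w‖ := norm_fst_le w
    have h2 : ‖w.2‖ ≤ ‖w‖ := norm_snd_le w
    change ‖w.1‖ ^ 2 + ‖w.2‖ ^ 2 ≤ _
    nlinarith [norm_nonneg w.1, norm_nonneg w.2, norm_nonneg w]
  calc ‖gradVec φ z‖ * ‖WithLp.toLp 2 w‖ ≤ ‖gradVec φ z‖ * (2 * ‖w‖) := by gcongr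
    _ = _ := by ring

/-- Reflecting in the boundary hyperplane shows that a function of `(x, |y|)` has twice the
integral over the whole space that it has over the half-space. -/
theorem lintegral_comp_abs_snd {N : ℕ} {H : Pt N → ℝ≥0∞} (hH : Measurable H) :
    ∫⁻ z : Pt N, H (z.1, |z.2|) = 2 * ∫⁻ z, H z ∂(halfMeasure N) := by
  have hm : Measurable fun z : Pt N => H (z.1, |z.2|) := hH.comp (by fun_prop)
  have h1D : ∀ h : ℝ → ℝ≥0∞, ∫⁻ y, h |y| = 2 * ∫⁻ y in Set.Ioi 0, h y := by
    intro h
    have e1 : ∫⁻ y in Set.Ioi 0, h |y| = ∫⁻ y in Set.Ioi 0, h y :=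
      setLIntegral_congr_fun measurableSet_Ioi fun y hy => by rw [abs_of_pos hy]
    have e2 : ∫⁻ y in Set.Iic 0, h |y| = ∫⁻ y in Set.Ioi 0, h y := by
      have hmp := (Measure.measurePreserving_neg (volume : Measure ℝ))
      have := hmp.setLIntegral_comp_emb (MeasurableEquiv.neg ℝ).measurableEmbedding
        (fun y => h |y|) (Set.Ici 0)
      rw [Set.image_neg_Ici, neg_zero] at this
      rw [← this, setLIntegral_congr Ioi_ae_eq_Ici.symm, ← e1]
      simp only [abs_neg]
    rw [← lintegral_add_compl _ measurableSet_Ioi, Set.compl_Ioi, e1, e2, two_mul]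
  rw [halfMeasure_eq_prod, Measure.volume_eq_prod, lintegral_prod _ hm.aemeasurable,
    lintegral_prod _ hH.aemeasurable, ← lintegral_const_mul' _ _ (by norm_num)]
  exact lintegral_congr fun x => h1D fun y => H (x, y)

/-- The Gagliardo-Nirenberg-Sobolev inequality on the half-space. -/
theorem exists_eLpNorm_le_gradVec (N : ℕ) {p : ℝ≥0}
    (hp : (p : ℝ)⁻¹ = 2⁻¹ - ((N : ℝ) + 1)⁻¹) :
    ∃ C : ℝ≥0, ∀ φ : testFunctions N, eLpNorm (φ : Pt N → ℝ) p (halfMeasure N) ≤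
      C * eLpNorm (gradVec (φ : Pt N → ℝ)) 2 (halfMeasure N) := by
  let C₀ : ℝ≥0 := SNormLESNormFDerivOfEqConst ℝ (volume : Measure (Pt N)) 2
  refine ⟨C₀ * 4, fun ⟨φ, hφ, hc⟩ => ?_⟩
  have hφ1 : ContDiff ℝ 1 φ := hφ.of_le (by simp)
  let s : ℕ → ℝ := fun n => ((n : ℝ) + 1)⁻¹
  have hs0 : ∀ n, s n ≠ 0 := fun n => by positivity
  have hslim : Tendsto s atTop (𝓝 0) := by
    simpa [s, one_div] using tendsto_one_div_add_atTop_nhds_zero_nat (𝕜 := ℝ)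
  have hfin : Module.finrank ℝ (Pt N) = N + 1 := by simp
  have hlim : ∀ z : Pt N, Tendsto (fun n => smoothFold (s n) z) atTop (𝓝 (z.1, |z.2|)) := by
    intro z
    have h1 : Tendsto (fun n => √(z.2 ^ 2 + s n ^ 2)) atTop (𝓝 √(z.2 ^ 2 + 0 ^ 2)) :=
      (Real.continuous_sqrt.tendsto _).comp ((hslim.pow 2).const_add _)
    have h2 : √(z.2 ^ 2 + 0 ^ 2) = |z.2| := by simp [Real.sqrt_sq_eq_abs]
    rw [h2] at h1
    exact tendsto_const_nhds.prodMk_nhds h1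
  have hfd : Continuous fun z => ‖fderiv ℝ φ z‖ := (hφ1.continuous_fderiv one_ne_zero).norm
  have hfdc : HasCompactSupport fun z => ‖fderiv ℝ φ z‖ := (hc.fderiv ℝ).norm
  -- The Sobolev inequality on the whole space, for the composition with the smooth fold, which is
  -- nonexpansive for the maximum norm.
  have hgns : ∀ n, eLpNorm (fun z => φ (smoothFold (s n) z)) p (halfMeasure N) ≤
      C₀ * eLpNorm (fun z => ‖fderiv ℝ φ (smoothFold (s n) z)‖) 2 volume := by
    intro n
    have h1 := eLpNorm_le_eLpNorm_fderiv_of_eq (volume : Measure (Pt N)) (p := 2) (p' := p)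
      ((hφ.comp (contDiff_smoothFold (hs0 n))).of_le (by simp))
      (hasCompactSupport_comp_smoothFold hc (s n)) (by norm_num) (by rw [hfin]; omega)
      (by rw [hp, hfin]; push_cast; ring)
    refine (eLpNorm_restrict_le _ _ _ _).trans (h1.trans ?_)
    refine mul_le_mul_right (eLpNorm_mono fun z => ?_) _
    rw [fderiv_comp _ (hφ1.differentiable one_ne_zero _)
      ((contDiff_smoothFold (hs0 n)).differentiable (by simp) _), norm_norm]
    exact (ContinuousLinearMap.opNorm_comp_le _ _).trans
      (mul_le_of_le_one_right (norm_nonneg _) (norm_fderiv_smoothFold_le (hs0 n) z))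
  have hfold : Continuous fun z : Pt N => (z.1, |z.2|) := by fun_prop
  have hdom : Tendsto (fun n => eLpNorm (fun z => ‖fderiv ℝ φ (smoothFold (s n) z)‖ -
      ‖fderiv ℝ φ (z.1, |z.2|)‖) 2 volume) atTop (𝓝 0) := by
    obtain ⟨R, hR⟩ := hfdc.isCompact.isBounded.subset_closedBall (0 : Pt N)
    obtain ⟨C, hC⟩ := hfdc.exists_bound_of_continuous hfd
    have hzero : ∀ z : Pt N, R < ‖z‖ → ‖fderiv ℝ φ z‖ = 0 := by
      intro z hz
      by_contra h
      have := hR (subset_tsupport _ h)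
      rw [mem_closedBall_zero_iff] at this
      linarith
    refine tendsto_eLpNorm_two_zero
      (g := (Metric.closedBall (0 : Pt N) R).indicator fun _ => C + C) ?_ (fun n => ?_)
      (fun n z => ?_) fun z => ?_
    · exact memLp_indicator_const 2 Metric.isClosed_closedBall.measurableSet _
        (Or.inr (measure_closedBall_lt_top).ne)
    · exact ((hfd.comp (contDiff_smoothFold (hs0 n)).continuous).sub
        (hfd.comp hfold)).aestronglyMeasurable
    · by_cases hz : z ∈ Metric.closedBall (0 : Pt N) R
      · rw [Set.indicator_of_mem hz]
        exact (norm_sub_le _ _).trans (add_le_add (hC _) (hC _))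
      · rw [mem_closedBall_zero_iff, not_le] at hz
        have h0 : ‖z‖ ≤ ‖((z.1, |z.2|) : Pt N)‖ := by
          rw [Prod.norm_def, Prod.norm_def]
          simp
        rw [hzero _ (hz.trans_le (norm_le_norm_smoothFold _ _)), hzero _ (hz.trans_le h0),
          Set.indicator_of_notMem (by rw [mem_closedBall_zero_iff, not_le]; exact hz)]
        simp
    · have := ((hfd.tendsto _).comp (hlim z)).sub_const ‖fderiv ℝ φ (z.1, |z.2|)‖
      simpa using this
  have hlimit : eLpNorm (fun z : Pt N => ‖fderiv ℝ φ (z.1, |z.2|)‖) 2 volume ≤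
      4 * eLpNorm (gradVec φ) 2 (halfMeasure N) := by
    rw [← ENNReal.pow_le_pow_left_iff two_ne_zero, eLpNorm_two_sq, mul_pow, eLpNorm_two_sq]
    have hm : Measurable fun z => ‖‖fderiv ℝ φ z‖‖ₑ ^ 2 := hfd.measurable.enorm.pow_const 2
    rw [lintegral_comp_abs_snd hm]
    have : ∫⁻ z, ‖‖fderiv ℝ φ z‖‖ₑ ^ 2 ∂(halfMeasure N) ≤
        4 * ∫⁻ z, ‖gradVec φ z‖ₑ ^ 2 ∂(halfMeasure N) := by
      rw [← lintegral_const_mul' _ _ (by norm_num)]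
      refine lintegral_mono fun z => ?_
      have h2 : ‖‖fderiv ℝ φ z‖‖ₑ ≤ 2 * ‖gradVec φ z‖ₑ := by
        rw [enorm_norm, ← ofReal_norm]
        refine (ENNReal.ofReal_le_ofReal (norm_fderiv_le_gradVec φ z)).trans_eq ?_
        rw [ENNReal.ofReal_mul zero_le_two, ofReal_norm, ENNReal.ofReal_ofNat]
      refine (pow_le_pow_left' h2 2).trans_eq ?_
      rw [mul_pow]
      norm_num
    calc _ ≤ 2 * (4 * ∫⁻ z, ‖gradVec φ z‖ₑ ^ 2 ∂(halfMeasure N)) := by gcongr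
      _ ≤ _ := by
        rw [← mul_assoc]
        gcongr
        norm_num
  have hle : ∀ n, eLpNorm (fun z => φ (smoothFold (s n) z)) p (halfMeasure N) ≤
      C₀ * (eLpNorm (fun z => ‖fderiv ℝ φ (smoothFold (s n) z)‖ -
      ‖fderiv ℝ φ (z.1, |z.2|)‖) 2 volume + 4 * eLpNorm (gradVec φ) 2 (halfMeasure N)) := by
    intro n
    refine (hgns n).trans (mul_le_mul_right ?_ _)
    refine le_trans ?_ (add_le_add_right hlimit _)
    have := eLpNorm_add_le (μ := (volume : Measure (Pt N))) (p := 2)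
      ((hfd.comp (contDiff_smoothFold (hs0 n)).continuous).sub
        (hfd.comp hfold)).aestronglyMeasurable
      (hfd.comp hfold).aestronglyMeasurable (by norm_num)
    rwa [sub_add_cancel] at this
  have hT : Tendsto (fun n => (C₀ : ℝ≥0∞) * (eLpNorm (fun z =>
      ‖fderiv ℝ φ (smoothFold (s n) z)‖ - ‖fderiv ℝ φ (z.1, |z.2|)‖) 2 volume +
      4 * eLpNorm (gradVec φ) 2 (halfMeasure N))) atTop
      (𝓝 (C₀ * (0 + 4 * eLpNorm (gradVec φ) 2 (halfMeasure N)))) :=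
    ENNReal.Tendsto.const_mul (hdom.add_const _) (Or.inr ENNReal.coe_ne_top)
  rw [zero_add, ← mul_assoc] at hT
  calc eLpNorm φ p (halfMeasure N)
      ≤ atTop.liminf fun n => eLpNorm (fun z => φ (smoothFold (s n) z)) p (halfMeasure N) := by
        refine Lp.eLpNorm_lim_le_liminf_eLpNorm (fun n => (hφ.continuous.comp
          (contDiff_smoothFold (hs0 n)).continuous).aestronglyMeasurable) _ ?_
        filter_upwards [ae_restrict_mem (isOpen_halfSpace N).measurableSet] with z hz
        have h := (hφ.continuous.tendsto _).comp (hlim z)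
        rwa [abs_of_pos hz] at h
    _ ≤ _ := (liminf_le_liminf (Eventually.of_forall hle)).trans hT.liminf_eq.le
    _ = _ := by push_cast; rfl

/-- The critical trace inequality. -/
theorem exists_eLpNorm_boundary_le (N : ℕ) (hN : 2 ≤ N) :
    ∃ K : ℝ≥0, ∀ φ : testFunctions N, eLpNorm (fun x => (φ : Pt N → ℝ) (x, 0))
      (ENNReal.ofReal (2 * (N : ℝ) / ((N : ℝ) - 1))) volume ≤
      K * eLpNorm (gradVec (φ : Pt N → ℝ)) 2 (halfMeasure N) := by
  have hN' : (2 : ℝ) ≤ N := by exact_mod_cast hN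
  have hN1 : 0 < (N : ℝ) - 1 := by linarith
  set r : ℝ := 2 * (N : ℝ) / ((N : ℝ) - 1) with hr
  have hr1 : 1 < r := by
    rw [hr, lt_div_iff₀ hN1]
    linarith
  -- Cauchy-Schwarz produces the exponent `2(r - 1)`, which is the critical Sobolev exponent in
  -- dimension `N + 1`.
  let p : ℝ≥0 := ⟨2 * (r - 1), by linarith⟩
  have hp : (p : ℝ) = 2 * (r - 1) := rfl
  have hp0 : 0 < (p : ℝ) := by rw [hp]; linarith
  obtain ⟨C, hC⟩ := exists_eLpNorm_le_gradVec N (p := p) (by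
    have hN2 : (N : ℝ) + 1 ≠ 0 := by positivity
    have e : r - 1 = (N + 1) / (N - 1) := by
      rw [hr]
      field_simp
      ring
    rw [hp, e]
    field_simp
    ring)
  let K : ℝ≥0 := (r.toNNReal * C ^ (r - 1)) ^ r⁻¹
  refine ⟨K, fun φ => ?_⟩
  have h := lintegral_boundary_rpow_le φ Set.univ hr1
  rw [Measure.restrict_univ, Set.preimage_univ, Measure.restrict_univ] at h
  set G := eLpNorm (gradVec (φ : Pt N → ℝ)) 2 (halfMeasure N) with hG
  have hφc : Continuous (φ : Pt N → ℝ) := φ.2.1.continuous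
  have h2 : (∫⁻ z, ‖(φ : Pt N → ℝ) z‖ₑ ^ (r - 1) * ‖gradVec (φ : Pt N → ℝ) z‖ₑ
      ∂(halfMeasure N)) ≤ (C * G) ^ (r - 1) * G := by
    have hcs := sq_lintegral_mul_le (halfMeasure N)
      (f := fun z => ‖(φ : Pt N → ℝ) z‖ₑ ^ (r - 1)) (g := fun z => ‖gradVec (φ : Pt N → ℝ) z‖ₑ)
      (hφc.measurable.enorm.pow_const _).aemeasurable
      (continuous_gradVec (testFunctions.contDiff_one φ)).measurable.enorm.aemeasurable
    rw [← eLpNorm_two_sq, ← hG] at hcs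
    rw [← ENNReal.pow_le_pow_left_iff two_ne_zero, mul_pow]
    refine hcs.trans ?_
    gcongr
    have e1 : ∀ x : ℝ≥0∞, (x ^ (r - 1)) ^ 2 = x ^ (p : ℝ) := fun x => by
      rw [← ENNReal.rpow_natCast, ← ENNReal.rpow_mul, hp, mul_comm]
      norm_num
    simp only [e1]
    rw [← eLpNorm_nnreal_pow_eq_lintegral (by exact_mod_cast hp0.ne')]
    exact ENNReal.rpow_le_rpow (hC φ) hp0.le
  have h3 : eLpNorm (fun x => (φ : Pt N → ℝ) (x, 0)) (ENNReal.ofReal r) volume ^ r ≤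
      (K * G) ^ r := by
    have e2 := eLpNorm_nnreal_pow_eq_lintegral (f := fun x => (φ : Pt N → ℝ) (x, 0))
      (μ := (volume : Measure (EuclideanSpace ℝ (Fin N)))) (p := r.toNNReal)
      (Real.toNNReal_pos.2 (by linarith)).ne'
    rw [Real.coe_toNNReal _ (by linarith)] at e2
    have e3 : ((K : ℝ≥0∞) * G) ^ r = ENNReal.ofReal r * ((C * G) ^ (r - 1) * G) := by
      have e4 : (K : ℝ≥0∞) ^ r = ENNReal.ofReal r * (C : ℝ≥0∞) ^ (r - 1) := by
        rw [← ENNReal.coe_rpow_of_nonneg _ (by linarith), ← NNReal.rpow_mul,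
          inv_mul_cancel₀ (by linarith), NNReal.rpow_one, ENNReal.coe_mul,
          ENNReal.coe_rpow_of_nonneg _ (by linarith)]
        rfl
      have e5 : G ^ r = G ^ (r - 1) * G := by
        conv_rhs => rw [← ENNReal.rpow_one G, ← ENNReal.rpow_mul, one_mul]
        rw [← ENNReal.rpow_add_of_nonneg _ _ (by linarith) zero_le_one, sub_add_cancel]
      rw [ENNReal.mul_rpow_of_nonneg _ _ (by linarith), e4, e5,
        ENNReal.mul_rpow_of_nonneg _ _ (by linarith)]
      ring
    rw [e3]
    refine (le_of_eq e2).trans (h.trans ?_)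
    gcongr
  exact (ENNReal.rpow_le_rpow_iff (by linarith)).1 h3

/-! ### The trace operator and the energy space -/

theorem testFunctions.memLp_boundary {N : ℕ} (φ : testFunctions N) :
    MemLp (fun x : EuclideanSpace ℝ (Fin N) => (φ : Pt N → ℝ) (x, 0)) 2 volume := by
  refine Continuous.memLp_of_hasCompactSupport (φ.2.1.continuous.comp (by fun_prop)) ?_
  exact φ.2.2.comp_isClosedEmbedding (g := fun x : EuclideanSpace ℝ (Fin N) => (x, (0 : ℝ)))
    (Topology.IsClosedEmbedding.of_continuous_injective_isClosedMap
      (by fun_prop) (Prod.mk_left_injective 0) (isClosedMap_prodMk_right 0))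

/-- The boundary values `φ ↦ φ(·, 0)` of test functions. -/
def boundary (N : ℕ) : testFunctions N →ₗ[ℝ] BoundaryLp N 2 where
  toFun φ := (testFunctions.memLp_boundary φ).toLp _
  map_add' _ _ := rfl
  map_smul' _ _ := rfl

theorem coeFn_boundary {N : ℕ} (φ : testFunctions N) :
    boundary N φ =ᵐ[volume] fun x => (φ : Pt N → ℝ) (x, 0) :=
  (testFunctions.memLp_boundary φ).coeFn_toLp

theorem norm_LpToLpRestrictCLM {X F : Type*} [MeasurableSpace X] [NormedAddCommGroup F]
    [NormedSpace ℝ F] {μ : Measure X} (s : Set X) (f : Lp F 2 μ) :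
    ‖LpToLpRestrictCLM X F ℝ μ 2 s f‖ = (eLpNorm f 2 (μ.restrict s)).toReal := by
  rw [Lp.norm_def, eLpNorm_congr_ae (LpToLpRestrictCLM_coeFn ℝ s f)]

theorem norm_grad_ofTest {N : ℕ} (φ : testFunctions N) :
    ‖SobolevH1.grad N (ofTest N φ)‖ =
      (eLpNorm (gradVec (φ : Pt N → ℝ)) 2 (halfMeasure N)).toReal := by
  rw [grad_ofTest, Lp.norm_toLp]

theorem norm_restrict_boundary_sq_le {N : ℕ} (φ : testFunctions N)
    (A : Set (EuclideanSpace ℝ (Fin N))) :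
    ‖LpToLpRestrictCLM _ ℝ ℝ volume 2 A (boundary N φ)‖ ^ 2 ≤
      2 * (‖LpToLpRestrictCLM _ ℝ ℝ (halfMeasure N) 2 (Prod.fst ⁻¹' A)
        (SobolevH1.toL2 N (ofTest N φ))‖ * ‖SobolevH1.grad N (ofTest N φ)‖) := by
  have h := eLpNorm_boundary_sq_le φ A
  have h1 : eLpNorm (SobolevH1.toL2 N (ofTest N φ)) 2
      ((halfMeasure N).restrict (Prod.fst ⁻¹' A)) =
      eLpNorm (φ : Pt N → ℝ) 2 ((halfMeasure N).restrict (Prod.fst ⁻¹' A)) :=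
    eLpNorm_congr_ae (ae_restrict_of_ae (testFunctions.memLp φ).coeFn_toLp)
  rw [norm_LpToLpRestrictCLM, norm_LpToLpRestrictCLM, norm_grad_ofTest,
    eLpNorm_congr_ae (ae_restrict_of_ae (coeFn_boundary φ)), h1, ← ENNReal.toReal_mul,
    ← ENNReal.toReal_pow]
  have h2 := ENNReal.toReal_mono (ENNReal.mul_ne_top (by norm_num) (ENNReal.mul_ne_top
    ((testFunctions.memLp φ).restrict _).eLpNorm_ne_top
    (testFunctions.memLp_gradVec φ).eLpNorm_ne_top)) h
  rwa [ENNReal.toReal_mul, ENNReal.toReal_ofNat] at h2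

theorem norm_boundary_le {N : ℕ} (φ : testFunctions N) : ‖boundary N φ‖ ≤ 1 * ‖ofTest N φ‖ := by
  have h := norm_restrict_boundary_sq_le φ Set.univ
  have hr : ‖LpToLpRestrictCLM _ ℝ ℝ (halfMeasure N) 2 (Prod.fst ⁻¹' Set.univ)
      (SobolevH1.toL2 N (ofTest N φ))‖ ≤ ‖SobolevH1.toL2 N (ofTest N φ)‖ :=
    norm_Lp_toLp_restrict_le _ _
  rw [norm_LpToLpRestrictCLM, Measure.restrict_univ, ← Lp.norm_def] at h
  rw [one_mul]
  refine le_of_sq_le_sq (h.trans ?_) (norm_nonneg _)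
  rw [SobolevH1.norm_sq]
  have h2 := mul_le_mul_of_nonneg_right hr (norm_nonneg (SobolevH1.grad N (ofTest N φ)))
  linarith [two_mul_le_add_sq ‖SobolevH1.toL2 N (ofTest N φ)‖ ‖SobolevH1.grad N (ofTest N φ)‖]

/-- An element of `H¹` is determined by the function alone, without its gradient. -/
theorem eq_ofTest {N : ℕ} {v : SobolevH1 N} (φ : testFunctions N)
    (h : SobolevH1.toL2 N v =ᵐ[halfMeasure N] (φ : Pt N → ℝ)) : v = ofTest N φ :=
  SobolevH1.toL2_injective (Lp.ext (h.trans (testFunctions.memLp φ).coeFn_toLp.symm))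

theorem isTraceOperator_iff {N : ℕ} {tr : SobolevH1 N →L[ℝ] BoundaryLp N 2} :
    IsTraceOperator tr ↔ ∀ φ, tr (ofTest N φ) = boundary N φ := by
  constructor
  · intro h φ
    refine Lp.ext ?_
    exact (h φ φ.2.1 φ.2.2 _ (testFunctions.memLp φ).coeFn_toLp).trans (coeFn_boundary φ).symm
  · intro h φ hφ hc v hv
    rw [eq_ofTest ⟨φ, hφ, hc⟩ hv, h]
    exact coeFn_boundary _

/-- Existence and uniqueness of the trace operator. -/
theorem existsUnique_isTraceOperator (N : ℕ) :
    ∃! tr : SobolevH1 N →L[ℝ] BoundaryLp N 2, IsTraceOperator tr := by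
  refine ⟨(boundary N).extendOfNorm (ofTest N), isTraceOperator_iff.2 fun φ =>
    LinearMap.extendOfNorm_eq (denseRange_ofTest N) ⟨1, norm_boundary_le⟩ φ,
    fun tr (h : IsTraceOperator tr) => ?_⟩
  rw [isTraceOperator_iff] at h
  exact (LinearMap.extendOfNorm_unique (denseRange_ofTest N) 1 norm_boundary_le tr
    (LinearMap.ext h)).symm

/-- The `L²` trace inequality on `H¹`, localized over boundary points in `A`. -/
theorem IsTraceOperator.norm_restrict_sq_le {N : ℕ} {tr : SobolevH1 N →L[ℝ] BoundaryLp N 2}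
    (h : IsTraceOperator tr) (A : Set (EuclideanSpace ℝ (Fin N))) (v : SobolevH1 N) :
    ‖LpToLpRestrictCLM _ ℝ ℝ volume 2 A (tr v)‖ ^ 2 ≤
      2 * (‖LpToLpRestrictCLM _ ℝ ℝ (halfMeasure N) 2 (Prod.fst ⁻¹' A) (SobolevH1.toL2 N v)‖ *
        ‖SobolevH1.grad N v‖) := by
  rw [isTraceOperator_iff] at h
  have c1 := SobolevH1.continuous_toL2 N
  have c2 := SobolevH1.continuous_grad N
  refine (denseRange_ofTest N).induction_on v (isClosed_le (by fun_prop) (by fun_prop)) fun φ => ?_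
  rw [h]
  exact norm_restrict_boundary_sq_le φ A

theorem measurePreserving_add_right_volume {N : ℕ} (k : EuclideanSpace ℝ (Fin N)) :
    MeasurePreserving (fun x => x + k) (volume : Measure (EuclideanSpace ℝ (Fin N))) volume :=
  measurePreserving_add_right volume k

/-- Traces depend continuously on translations, uniformly on bounded sets of `H¹`. -/
theorem IsTraceOperator.norm_shift_sub_sq_le {N : ℕ} {tr : SobolevH1 N →L[ℝ] BoundaryLp N 2}
    (h : IsTraceOperator tr) (k : EuclideanSpace ℝ (Fin N)) (v : SobolevH1 N) :
    ‖Lp.compMeasurePreservingₗᵢ ℝ _ (measurePreserving_add_right_volume k) (tr v) - tr v‖ ^ 2 ≤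
      4 * ‖k‖ * ‖SobolevH1.grad N v‖ ^ 2 := by
  rw [isTraceOperator_iff] at h
  have c2 := SobolevH1.continuous_grad N
  refine (denseRange_ofTest N).induction_on v (isClosed_le (by fun_prop) (by fun_prop)) fun φ => ?_
  have h1 := eLpNorm_boundary_shift_sub_sq_le φ k
  have h2 : eLpNorm (Lp.compMeasurePreservingₗᵢ ℝ _ (measurePreserving_add_right_volume k)
      (boundary N φ) - boundary N φ : BoundaryLp N 2) 2 volume =
      eLpNorm (fun x => (φ : Pt N → ℝ) (x + k, 0) - (φ : Pt N → ℝ) (x, 0)) 2 volume := by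
    refine eLpNorm_congr_ae ?_
    filter_upwards [Lp.coeFn_sub (Lp.compMeasurePreservingₗᵢ ℝ _
      (measurePreserving_add_right_volume k) (boundary N φ)) (boundary N φ), coeFn_boundary φ,
      (measurePreserving_add_right_volume k).quasiMeasurePreserving.ae (coeFn_boundary φ),
      Lp.coeFn_compMeasurePreserving (boundary N φ) (measurePreserving_add_right_volume k)]
      with x e1 e2 e3 e4
    rw [e1, Pi.sub_apply, e2, ← e3]
    exact congrArg (· - _) e4
  rw [h, Lp.norm_def, h2, norm_grad_ofTest, ← ENNReal.toReal_pow, ← ENNReal.toReal_pow]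
  have h3 := ENNReal.toReal_mono (ENNReal.mul_ne_top (by finiteness)
    (ENNReal.pow_ne_top (testFunctions.memLp_gradVec φ).eLpNorm_ne_top)) h1
  simpa only [ENNReal.toReal_mul, ENNReal.toReal_ofNat, toReal_enorm] using h3

/-- Tangential difference quotients of functions in `H¹` are bounded by the gradient. -/
theorem SobolevH1.norm_shift_sub_le {N : ℕ} (k : EuclideanSpace ℝ (Fin N)) (v : SobolevH1 N) :
    ‖Lp.compMeasurePreservingₗᵢ ℝ _ (measurePreserving_tangentialShift k) (SobolevH1.toL2 N v) -
      SobolevH1.toL2 N v‖ ≤ ‖k‖ * ‖SobolevH1.grad N v‖ := by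
  have c1 := SobolevH1.continuous_toL2 N
  have c2 := SobolevH1.continuous_grad N
  refine (denseRange_ofTest N).induction_on v (isClosed_le (by fun_prop) (by fun_prop)) fun φ => ?_
  have h1 := eLpNorm_shift_sub_le φ k
  have h2 : eLpNorm (Lp.compMeasurePreservingₗᵢ ℝ _ (measurePreserving_tangentialShift k)
      (SobolevH1.toL2 N (ofTest N φ)) - SobolevH1.toL2 N (ofTest N φ) :
        Lp ℝ 2 (halfMeasure N)) 2 (halfMeasure N) =
      eLpNorm (fun z => (φ : Pt N → ℝ) (tangentialShift k z) - (φ : Pt N → ℝ) z) 2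
        (halfMeasure N) := by
    have hφ : SobolevH1.toL2 N (ofTest N φ) =ᵐ[halfMeasure N] (φ : Pt N → ℝ) :=
      (testFunctions.memLp φ).coeFn_toLp
    refine eLpNorm_congr_ae ?_
    filter_upwards [Lp.coeFn_sub (Lp.compMeasurePreservingₗᵢ ℝ _
      (measurePreserving_tangentialShift k) (SobolevH1.toL2 N (ofTest N φ)))
        (SobolevH1.toL2 N (ofTest N φ)), hφ,
      (measurePreserving_tangentialShift k).quasiMeasurePreserving.ae hφ,
      Lp.coeFn_compMeasurePreserving (SobolevH1.toL2 N (ofTest N φ))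
        (measurePreserving_tangentialShift k)] with x e1 e2 e3 e4
    rw [e1, Pi.sub_apply, e2, ← e3]
    exact congrArg (· - _) e4
  rw [Lp.norm_def, h2, norm_grad_ofTest]
  have h3 := ENNReal.toReal_mono (ENNReal.mul_ne_top (by finiteness)
    (testFunctions.memLp_gradVec φ).eLpNorm_ne_top) h1
  simpa only [ENNReal.toReal_mul, toReal_enorm] using h3

/-- The critical trace inequality on `H¹`. -/
theorem IsTraceOperator.exists_eLpNorm_le {N : ℕ} (hN : 2 ≤ N) : ∃ K : ℝ≥0,
    ∀ tr : SobolevH1 N →L[ℝ] BoundaryLp N 2, IsTraceOperator tr → ∀ v : SobolevH1 N,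
      eLpNorm (tr v) (ENNReal.ofReal (2 * (N : ℝ) / ((N : ℝ) - 1))) volume ≤
        K * ‖SobolevH1.grad N v‖ₑ := by
  obtain ⟨K, hK⟩ := exists_eLpNorm_boundary_le N hN
  refine ⟨K, fun tr h v => ?_⟩
  rw [isTraceOperator_iff] at h
  obtain ⟨u, hu, hlim⟩ := mem_closure_iff_seq_limit.1 (denseRange_ofTest N v)
  choose φ hφ using hu
  -- The bound does not pass to the limit by continuity, as the traces converge only in `L²`: it
  -- needs an almost everywhere convergent subsequence and Fatou's lemma.
  have h1 : Tendsto (fun n => boundary N (φ n)) atTop (𝓝 (tr v)) := by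
    refine ((tr.continuous.tendsto v).comp hlim).congr fun n => ?_
    rw [Function.comp_apply, ← hφ, h]
  obtain ⟨ns, hns, hae⟩ := (tendstoInMeasure_of_tendsto_Lp h1).exists_seq_tendsto_ae
  have h2 : Tendsto (fun n => (K : ℝ≥0∞) * ‖SobolevH1.grad N (u n)‖ₑ) atTop
      (𝓝 (K * ‖SobolevH1.grad N v‖ₑ)) :=
    ENNReal.Tendsto.const_mul (((SobolevH1.continuous_grad N).tendsto v).comp hlim).enorm
      (Or.inr ENNReal.coe_ne_top)
  refine (Lp.eLpNorm_lim_le_liminf_eLpNorm (fun n => Lp.aestronglyMeasurable _) _ hae).trans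
    ((liminf_le_liminf (Eventually.of_forall fun n => ?_)).trans
      (h2.comp hns.tendsto_atTop).liminf_eq.le)
  rw [eLpNorm_congr_ae (coeFn_boundary (φ (ns n))), Function.comp_apply, ← hφ]
  refine (hK _).trans_eq ?_
  rw [← Lp.enorm_toLp (hf := testFunctions.memLp_gradVec (φ (ns n))), grad_ofTest]

theorem EnergySpace.norm_sq_eq_add {N : ℕ} (v : EnergySpace N) :
    ‖v‖ ^ 2 = ‖SobolevH1.grad N (EnergySpace.toH1 N v)‖ ^ 2 + ‖EnergySpace.weighted N v‖ ^ 2 :=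
  WithLp.prod_norm_sq_eq_of_L2 (EnergySpace.toPair N v)

theorem EnergySpace.norm_grad_le {N : ℕ} (v : EnergySpace N) :
    ‖SobolevH1.grad N (EnergySpace.toH1 N v)‖ ≤ ‖v‖ :=
  le_of_sq_le_sq (by rw [v.norm_sq_eq_add]; nlinarith [sq_nonneg ‖EnergySpace.weighted N v‖])
    (norm_nonneg _)

theorem EnergySpace.norm_weighted_le {N : ℕ} (v : EnergySpace N) :
    ‖EnergySpace.weighted N v‖ ≤ ‖v‖ :=
  le_of_sq_le_sq (by
    rw [v.norm_sq_eq_add]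
    nlinarith [sq_nonneg ‖SobolevH1.grad N (EnergySpace.toH1 N v)‖]) (norm_nonneg _)

/-- The weight `|x|` controls the tails of functions in the energy space. -/
theorem EnergySpace.mul_norm_restrict_le {N : ℕ} (v : EnergySpace N) {R : ℝ} (hR : 0 ≤ R) :
    R * ‖LpToLpRestrictCLM _ ℝ ℝ (halfMeasure N) 2 (Prod.fst ⁻¹' {x | R ≤ ‖x‖})
      (SobolevH1.toL2 N (EnergySpace.toH1 N v))‖ ≤ ‖v‖ := by
  refine le_trans ?_ v.norm_weighted_le
  have hm : MeasurableSet (Prod.fst ⁻¹' {x | R ≤ ‖x‖} : Set (Pt N)) :=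
    measurable_fst (measurableSet_le measurable_const measurable_norm)
  have h1 : ‖EnergySpace.weighted N v‖ = (eLpNorm (fun z : Pt N =>
      ‖z.1‖ * SobolevH1.toL2 N (EnergySpace.toH1 N v) z) 2 (halfMeasure N)).toReal :=
    Lp.norm_toLp _ v.memLp_weighted
  have h2 : ∀ a : ℝ≥0∞, R * a.toReal = (ENNReal.ofReal R * a).toReal := fun a => by
    rw [ENNReal.toReal_mul, ENNReal.toReal_ofReal hR]
  rw [h1, norm_LpToLpRestrictCLM, h2]
  refine ENNReal.toReal_mono v.memLp_weighted.eLpNorm_ne_top ?_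
  rw [← Real.enorm_of_nonneg hR, ← eLpNorm_const_smul]
  refine (eLpNorm_mono_ae ?_).trans (eLpNorm_restrict_le _ _ _ (Prod.fst ⁻¹' {x | R ≤ ‖x‖}))
  filter_upwards [ae_restrict_mem hm] with z hz
  rw [Pi.smul_apply, norm_smul, norm_mul, norm_norm, Real.norm_of_nonneg hR]
  exact mul_le_mul_of_nonneg_right hz (norm_nonneg _)

/-- The `L²` norm is controlled by the energy norm: a tangential translation of length `2` moves
the cylinder `|x| < 1` into the region `|x| ≥ 1`, where the weight is at least `1`. -/
theorem EnergySpace.norm_toL2_le {N : ℕ} (hN : 1 ≤ N) (v : EnergySpace N) :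
    ‖SobolevH1.toL2 N (EnergySpace.toH1 N v)‖ ≤ 4 * ‖v‖ := by
  have : Nonempty (Fin N) := ⟨⟨0, hN⟩⟩
  obtain ⟨k, hk⟩ := exists_norm_eq (EuclideanSpace ℝ (Fin N)) (zero_le_two (α := ℝ))
  set f := SobolevH1.toL2 N (EnergySpace.toH1 N v) with hf
  set S := Lp.compMeasurePreservingₗᵢ (E := ℝ) (p := 2) ℝ _
    (measurePreserving_tangentialShift k)
  let B : Set (Pt N) := Prod.fst ⁻¹' {x | 1 ≤ ‖x‖}
  have hB : MeasurableSet B := measurable_fst (measurableSet_le measurable_const measurable_norm)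
  have h1 : eLpNorm f 2 ((halfMeasure N).restrict B) ≤ ENNReal.ofReal ‖v‖ := by
    have := v.mul_norm_restrict_le zero_le_one
    rw [one_mul, norm_LpToLpRestrictCLM] at this
    exact (ENNReal.le_ofReal_iff_toReal_le ((Lp.memLp f).restrict _).eLpNorm_ne_top
      (norm_nonneg _)).2 this
  have h2 : eLpNorm (f ∘ tangentialShift k) 2 ((halfMeasure N).restrict Bᶜ) ≤
      ENNReal.ofReal ‖v‖ := by
    refine le_trans ?_ h1
    have hsub : Bᶜ ⊆ tangentialShift k ⁻¹' B := by
      intro z hz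
      simp only [B, Set.mem_compl_iff, Set.mem_preimage, Set.mem_ofPred_eq, not_le] at hz ⊢
      have h3 : ‖k‖ ≤ ‖z.1 + k‖ + ‖z.1‖ := by
        simpa using norm_sub_le (z.1 + k) z.1
      change 1 ≤ ‖z.1 + k‖
      linarith
    refine (eLpNorm_mono_measure _ (Measure.restrict_mono hsub le_rfl)).trans_eq ?_
    exact eLpNorm_comp_measurePreserving (Lp.aestronglyMeasurable f).restrict
      ((measurePreserving_tangentialShift k).restrict_preimage hB)
  have h3 : eLpNorm (⇑f ∘ tangentialShift k - ⇑f) 2 (halfMeasure N) ≤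
      ENNReal.ofReal (2 * ‖v‖) := by
    have h := SobolevH1.norm_shift_sub_le k (EnergySpace.toH1 N v)
    rw [← hf, Lp.norm_def, hk] at h
    have h4 : eLpNorm (⇑f ∘ tangentialShift k - ⇑f) 2 (halfMeasure N) =
        eLpNorm (S f - f : Lp ℝ 2 (halfMeasure N)) 2 (halfMeasure N) := by
      refine eLpNorm_congr_ae ?_
      filter_upwards [Lp.coeFn_sub (S f) f, Lp.coeFn_compMeasurePreserving f
        (measurePreserving_tangentialShift k)] with z e1 e2
      rw [e1, Pi.sub_apply, Pi.sub_apply]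
      exact congrArg (· - _) e2.symm
    rw [h4]
    refine (ENNReal.le_ofReal_iff_toReal_le (Lp.eLpNorm_ne_top _) (by positivity)).2
      (h.trans ?_)
    gcongr
    exact v.norm_grad_le
  have hfm : AEStronglyMeasurable f (halfMeasure N) := Lp.aestronglyMeasurable f
  have hfs : AEStronglyMeasurable (f ∘ tangentialShift k) (halfMeasure N) :=
    hfm.comp_measurePreserving (measurePreserving_tangentialShift k)
  have h5 : eLpNorm f 2 ((halfMeasure N).restrict Bᶜ) ≤
      ENNReal.ofReal ‖v‖ + ENNReal.ofReal (2 * ‖v‖) := by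
    have e : (f : Pt N → ℝ) = f ∘ tangentialShift k - (⇑f ∘ tangentialShift k - ⇑f) := by simp
    rw [e]
    exact (eLpNorm_sub_le hfs.restrict (hfs.sub hfm).restrict (by norm_num)).trans
      (add_le_add h2 ((eLpNorm_restrict_le _ _ _ _).trans h3))
  rw [Lp.norm_def]
  refine ENNReal.toReal_le_of_le_ofReal (by positivity) ?_
  rw [← Set.indicator_self_add_compl B f]
  refine (eLpNorm_add_le (hfm.indicator hB) (hfm.indicator hB.compl) (by norm_num)).trans ?_
  rw [eLpNorm_indicator_eq_eLpNorm_restrict hB, eLpNorm_indicator_eq_eLpNorm_restrict hB.compl]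
  refine (add_le_add h1 h5).trans_eq ?_
  rw [← ENNReal.ofReal_add (by positivity) (by positivity),
    ← ENNReal.ofReal_add (by positivity) (by positivity)]
  congr 1
  ring

/-- The inclusion `𝓗 → H¹` as a bounded operator. -/
def EnergySpace.toH1L {N : ℕ} (hN : 1 ≤ N) : EnergySpace N →L[ℝ] SobolevH1 N :=
  (EnergySpace.toH1 N).mkContinuous 5 fun v => by
    linarith [SobolevH1.norm_le_add (EnergySpace.toH1 N v), v.norm_toL2_le hN, v.norm_grad_le]

/-! ### A Kolmogorov-Riesz compactness criterion -/

/-- An operator into a Hilbert space is compact if its values are uniformly close to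
finite-dimensional subspaces. -/
theorem isCompactOperator_of_finiteDimensional_approx {E H : Type*} [SeminormedAddCommGroup E]
    [NormedSpace ℝ E] [NormedAddCommGroup H] [InnerProductSpace ℝ H] [CompleteSpace H]
    (T : E →L[ℝ] H) (h : ∀ ε : ℝ, 0 < ε → ∃ F : Submodule ℝ H, FiniteDimensional ℝ F ∧
      ∀ v, ∃ g ∈ F, ‖T v - g‖ ≤ ε * ‖v‖) : IsCompactOperator T := by
  choose! F hF hT using h
  let s : ℕ → ℝ := fun n => 1 / ((n : ℝ) + 1)
  have hs0 : ∀ n, 0 < s n := fun n => by positivity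
  have : ∀ n, FiniteDimensional ℝ (F (s n)) := fun n => hF _ (hs0 n)
  refine isCompactOperator_of_tendsto (l := atTop)
    (F := fun n => (F (s n)).starProjection ∘L T) ?_ (Eventually.of_forall fun n => ?_)
  · refine tendsto_iff_norm_sub_tendsto_zero.2 (squeeze_zero (fun _ => norm_nonneg _) (fun n => ?_)
      (tendsto_one_div_add_atTop_nhds_zero_nat (𝕜 := ℝ)))
    refine ContinuousLinearMap.opNorm_le_bound _ (hs0 n).le fun v => ?_
    obtain ⟨g, hg, hgv⟩ := hT (s n) (hs0 n) v
    rw [← norm_neg]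
    have e : -(((F (s n)).starProjection ∘L T - T) v) =
        T v - (F (s n)).starProjection (T v) := by simp
    rw [e, Submodule.starProjection_minimal]
    exact (ciInf_le ⟨0, by rintro _ ⟨x, rfl⟩; exact norm_nonneg _⟩ (⟨g, hg⟩ : F (s n))).trans hgv
  · have h1 : IsCompactOperator (F (s n)).orthogonalProjectionOnto :=
      isCompactOperator_of_locallyCompactSpace_dom _
    exact (h1.clm_comp (F (s n)).subtypeL).comp_clm T

/-- The variance on `Q` is bounded by the mean square oscillation, by Cauchy-Schwarz. -/
theorem lintegral_sub_average_sq_le {α : Type*} [MeasurableSpace α] {μ : Measure α} {f : α → ℝ}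
    (hf : MemLp f 2 μ) (hfm : Measurable f) {Q : Set α} (hQ0 : μ Q ≠ 0)
    (hQ1 : μ Q ≠ ⊤) :
    ∫⁻ x in Q, ‖f x - ⨍ y in Q, f y ∂μ‖ₑ ^ 2 ∂μ ≤
      (μ Q)⁻¹ * ∫⁻ x in Q, ∫⁻ y in Q, ‖f y - f x‖ₑ ^ 2 ∂μ ∂μ := by
  set ν : Measure α := (μ Q)⁻¹ • μ.restrict Q with hν
  have hprob : IsProbabilityMeasure ν := ⟨by
    rw [hν, Measure.smul_apply, Measure.restrict_apply_univ, smul_eq_mul,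
      ENNReal.inv_mul_cancel hQ0 hQ1]⟩
  have hav : ⨍ y in Q, f y ∂μ = ∫ y, f y ∂ν := by
    rw [average_eq', Measure.restrict_apply_univ]
  have hfν : Integrable f ν :=
    ((hf.restrict Q).smul_measure (ENNReal.inv_ne_top.2 hQ0)).integrable (by norm_num)
  rw [← lintegral_const_mul' _ _ (ENNReal.inv_ne_top.2 hQ0)]
  refine lintegral_mono fun x => ?_
  have e : f x - ⨍ y in Q, f y ∂μ = -∫ y, (f y - f x) ∂ν := by
    rw [hav, integral_sub hfν (integrable_const _), integral_const, probReal_univ, one_smul]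
    ring
  rw [e, enorm_neg]
  have hm : Measurable fun y => ‖f y - f x‖ₑ := (hfm.sub_const _).enorm
  calc ‖∫ y, (f y - f x) ∂ν‖ₑ ^ 2 ≤ (∫⁻ y, ‖f y - f x‖ₑ ∂ν) ^ 2 :=
        pow_le_pow_left' (enorm_integral_le_lintegral_enorm _) 2
    _ ≤ ν Set.univ * ∫⁻ y, ‖f y - f x‖ₑ ^ 2 ∂ν := sq_lintegral_le ν hm.aemeasurable
    _ = (μ Q)⁻¹ * ∫⁻ y in Q, ‖f y - f x‖ₑ ^ 2 ∂μ := by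
        rw [measure_univ, one_mul, hν, lintegral_smul_measure, smul_eq_mul]

theorem coeFn_sum_smul_indicatorConstLp {α ι : Type*} [MeasurableSpace α] {μ : Measure α}
    {Q : ι → Set α} (hQ : ∀ j, MeasurableSet (Q j)) (hQ1 : ∀ j, μ (Q j) ≠ ⊤) (c : ι → ℝ)
    (J : Finset ι) :
    ⇑(∑ j ∈ J, c j • indicatorConstLp 2 (hQ j) (hQ1 j) (1 : ℝ)) =ᵐ[μ]
      fun x => ∑ j ∈ J, (Q j).indicator (fun _ => c j) x := by
  classical
  induction J using Finset.induction_on with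
  | empty =>
    simp only [Finset.sum_empty]
    exact Lp.coeFn_zero ℝ 2 μ
  | insert i J hi ih =>
    rw [Finset.sum_insert hi]
    filter_upwards [Lp.coeFn_add (c i • indicatorConstLp 2 (hQ i) (hQ1 i) (1 : ℝ))
      (∑ j ∈ J, c j • indicatorConstLp 2 (hQ j) (hQ1 j) (1 : ℝ)), ih,
      Lp.coeFn_smul (c i) (indicatorConstLp 2 (hQ i) (hQ1 i) (1 : ℝ)),
      indicatorConstLp_coeFn (p := 2) (hs := hQ i) (hμs := hQ1 i) (c := (1 : ℝ))]
      with x h1 h2 h3 h4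
    rw [h1, Pi.add_apply, h2, h3, Pi.smul_apply, h4, Finset.sum_insert hi]
    by_cases hx : x ∈ Q i <;> simp [hx]

/-- The half-open cube of side `h` with lower corner `h j`. -/
def gridCube {N : ℕ} (h : ℝ) (j : Fin N → ℤ) : Set (EuclideanSpace ℝ (Fin N)) :=
  {x | ∀ i, x i ∈ Set.Ico (j i * h) (j i * h + h)}

/-- The open cube of side `2h` centred at the origin. -/
def centredCube (N : ℕ) (h : ℝ) : Set (EuclideanSpace ℝ (Fin N)) :=
  {x | ∀ i, x i ∈ Set.Ioo (-h) h}

theorem measurableSet_box {N : ℕ} {s : Fin N → Set ℝ} (hs : ∀ i, MeasurableSet (s i)) :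
    MeasurableSet {x : EuclideanSpace ℝ (Fin N) | ∀ i, x i ∈ s i} := by
  have := (MeasurableSet.univ_pi hs).preimage (PiLp.volume_preserving_ofLp (Fin N)).measurable
  convert this using 1
  ext x
  simp

theorem volume_box {N : ℕ} {s : Fin N → Set ℝ} (hs : ∀ i, MeasurableSet (s i)) :
    volume {x : EuclideanSpace ℝ (Fin N) | ∀ i, x i ∈ s i} = ∏ i, volume (s i) := by
  have := (PiLp.volume_preserving_ofLp (Fin N)).measure_preimage
    (MeasurableSet.univ_pi hs).nullMeasurableSet
  rw [volume_pi_pi] at this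
  rw [← this]
  congr 1
  ext x
  simp

theorem measurableSet_gridCube {N : ℕ} (h : ℝ) (j : Fin N → ℤ) : MeasurableSet (gridCube h j) :=
  measurableSet_box fun _ => measurableSet_Ico

theorem measurableSet_centredCube (N : ℕ) (h : ℝ) : MeasurableSet (centredCube N h) :=
  measurableSet_box fun _ => measurableSet_Ioo

theorem volume_gridCube {N : ℕ} (h : ℝ) (j : Fin N → ℤ) :
    volume (gridCube h j) = ENNReal.ofReal h ^ N := by
  rw [gridCube, volume_box fun _ => measurableSet_Ico]
  simp

theorem volume_centredCube {N : ℕ} {h : ℝ} (hh : 0 ≤ h) :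
    volume (centredCube N h) = 2 ^ N * ENNReal.ofReal h ^ N := by
  rw [centredCube, volume_box fun _ => measurableSet_Ioo]
  have : ENNReal.ofReal (h + h) = 2 * ENNReal.ofReal h := by
    rw [ENNReal.ofReal_add hh hh, two_mul]
  simp [this, mul_pow]

theorem gridCube_eq_of_mem {N : ℕ} {h : ℝ} (hh : 0 < h) {j : Fin N → ℤ}
    {x : EuclideanSpace ℝ (Fin N)} (hx : x ∈ gridCube h j) : j = fun i => ⌊x i / h⌋ := by
  funext i
  obtain ⟨h1, h2⟩ := hx i
  symm
  rw [Int.floor_eq_iff]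
  constructor
  · exact (le_div_iff₀ hh).2 h1
  · rw [div_lt_iff₀ hh]
    linarith

theorem mem_gridCube_floor {N : ℕ} {h : ℝ} (hh : 0 < h) (x : EuclideanSpace ℝ (Fin N)) :
    x ∈ gridCube h fun i => ⌊x i / h⌋ := by
  intro i
  have h1 := Int.floor_le (x i / h)
  have h2 := Int.lt_floor_add_one (x i / h)
  rw [le_div_iff₀ hh] at h1
  rw [div_lt_iff₀ hh] at h2
  exact ⟨h1, by linarith⟩

theorem pairwise_disjoint_gridCube {N : ℕ} {h : ℝ} (hh : 0 < h) :
    Pairwise (Function.onFun Disjoint (gridCube (N := N) h)) := fun _ _ hj =>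
  Set.disjoint_left.2 fun _ hx hx' =>
    hj ((gridCube_eq_of_mem hh hx).trans (gridCube_eq_of_mem hh hx').symm)

theorem sub_mem_centredCube {N : ℕ} {h : ℝ} {j : Fin N → ℤ} {x y : EuclideanSpace ℝ (Fin N)}
    (hx : x ∈ gridCube h j) (hy : y ∈ gridCube h j) : y - x ∈ centredCube N h := by
  intro i
  have h1 := hx i
  have h2 := hy i
  simp only [Set.mem_Ico] at h1 h2
  simp only [PiLp.sub_apply, Set.mem_Ioo]
  constructor <;> linarith [h1.1, h1.2, h2.1, h2.2]

/-- Replacing a function by its averages on the cubes of a grid costs at most its `L²` modulus of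
continuity. -/
theorem sum_lintegral_sub_average_sq_le {N : ℕ} {f : EuclideanSpace ℝ (Fin N) → ℝ}
    (hf : MemLp f 2 volume) (hfm : Measurable f) {h : ℝ} (hh : 0 < h)
    (J : Finset (Fin N → ℤ)) {η : ℝ≥0∞}
    (hη : ∀ k ∈ centredCube N h, eLpNorm (fun x => f (x + k) - f x) 2 volume ≤ η) :
    ∑ j ∈ J, ∫⁻ x in gridCube h j, ‖f x - ⨍ y in gridCube h j, f y‖ₑ ^ 2 ≤ 2 ^ N * η ^ 2 := by
  have hh0 : ENNReal.ofReal h ^ N ≠ 0 := pow_ne_zero _ (ENNReal.ofReal_pos.2 hh).ne'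
  have hh1 : ENNReal.ofReal h ^ N ≠ ⊤ := by finiteness
  have hm2 : Measurable fun p : EuclideanSpace ℝ (Fin N) × EuclideanSpace ℝ (Fin N) =>
      ‖f (p.1 + p.2) - f p.1‖ₑ ^ 2 :=
    (((hfm.comp (measurable_fst.add measurable_snd)).sub
      (hfm.comp measurable_fst)).enorm).pow_const 2
  -- Differences of points of one cube lie in `centredCube N h`, of volume `2^N` times the volume
  -- of the cube; hence the factor `2^N`.
  let D : EuclideanSpace ℝ (Fin N) → ℝ≥0∞ := fun x =>
    ∫⁻ k in centredCube N h, ‖f (x + k) - f x‖ₑ ^ 2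
  have hcube : ∀ j : Fin N → ℤ, ∫⁻ x in gridCube h j, ∫⁻ y in gridCube h j, ‖f y - f x‖ₑ ^ 2 ≤
      ∫⁻ x in gridCube h j, D x := by
    intro j
    refine setLIntegral_mono' (measurableSet_gridCube h j) fun x hx => ?_
    have e : D x = ∫⁻ k, (centredCube N h).indicator (fun k => ‖f (x + k) - f x‖ₑ ^ 2) k :=
      (lintegral_indicator (measurableSet_centredCube N h) _).symm
    rw [e, ← lintegral_sub_right_eq_self (fun k => (centredCube N h).indicator _ k) x,
      ← lintegral_indicator (measurableSet_gridCube h j)]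
    refine lintegral_mono fun y => ?_
    by_cases hy : y ∈ gridCube h j
    · rw [Set.indicator_of_mem hy, Set.indicator_of_mem (sub_mem_centredCube hx hy),
        add_sub_cancel]
    · simp [hy]
  calc ∑ j ∈ J, ∫⁻ x in gridCube h j, ‖f x - ⨍ y in gridCube h j, f y‖ₑ ^ 2
      ≤ ∑ j ∈ J, (ENNReal.ofReal h ^ N)⁻¹ * ∫⁻ x in gridCube h j, D x := by
        refine Finset.sum_le_sum fun j _ => ?_
        have hv := volume_gridCube h j
        refine (lintegral_sub_average_sq_le hf hfm (by rwa [hv]) (by rwa [hv])).trans ?_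
        rw [hv]
        exact mul_le_mul_right (hcube j) _
    _ = (ENNReal.ofReal h ^ N)⁻¹ * ∫⁻ x in ⋃ j ∈ J, gridCube h j, D x := by
        rw [← Finset.mul_sum, lintegral_biUnion_finset
          (fun i _ j _ hij => pairwise_disjoint_gridCube hh hij)
          (fun j _ => measurableSet_gridCube h j)]
    _ ≤ (ENNReal.ofReal h ^ N)⁻¹ * ∫⁻ x, D x :=
        mul_le_mul_right (setLIntegral_le_lintegral _ _) _
    _ = (ENNReal.ofReal h ^ N)⁻¹ * ∫⁻ k in centredCube N h, (∫⁻ x, ‖f (x + k) - f x‖ₑ ^ 2) := by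
        rw [lintegral_lintegral_swap hm2.aemeasurable]
    _ ≤ (ENNReal.ofReal h ^ N)⁻¹ * ∫⁻ k in centredCube N h, η ^ 2 := by
        refine mul_le_mul_right (setLIntegral_mono' (measurableSet_centredCube N h)
          fun k hk => ?_) _
        rw [← eLpNorm_two_sq]
        exact pow_le_pow_left' (hη k hk) 2
    _ = 2 ^ N * η ^ 2 := by
        rw [setLIntegral_const, volume_centredCube hh.le]
        calc _ = (ENNReal.ofReal h ^ N)⁻¹ * ENNReal.ofReal h ^ N * (2 ^ N * η ^ 2) := by ring
          _ = _ := by rw [ENNReal.inv_mul_cancel hh0 hh1, one_mul]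

/-- The step functions on the cubes of side `h` indexed by `J`. -/
def stepSpace {N : ℕ} (h : ℝ) (J : Finset (Fin N → ℤ)) : Submodule ℝ (BoundaryLp N 2) :=
  Submodule.span ℝ ((fun j => indicatorConstLp 2 (measurableSet_gridCube h j)
    (by rw [volume_gridCube]; finiteness) (1 : ℝ)) '' J)

instance {N : ℕ} (h : ℝ) (J : Finset (Fin N → ℤ)) : FiniteDimensional ℝ (stepSpace h J) :=
  FiniteDimensional.span_of_finite ℝ (J.finite_toSet.image _)

/-- The step function of the averages of `f` on the cubes in `J` is close to `f` in `L²`, up to the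
mass of `f` outside these cubes. -/
theorem exists_mem_stepSpace {N : ℕ} (f : BoundaryLp N 2) {h : ℝ} (hh : 0 < h)
    (J : Finset (Fin N → ℤ)) {η : ℝ≥0∞}
    (hη : ∀ k ∈ centredCube N h, eLpNorm (fun x => f (x + k) - f x) 2 volume ≤ η) :
    ∃ g ∈ stepSpace h J, eLpNorm (f - g : BoundaryLp N 2) 2 volume ^ 2 ≤
      2 ^ N * η ^ 2 + eLpNorm f 2 (volume.restrict (⋃ j ∈ J, gridCube h j)ᶜ) ^ 2 := by
  have hv : ∀ j : Fin N → ℤ, volume (gridCube h j) ≠ ⊤ := fun j => by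
    rw [volume_gridCube]; finiteness
  let c : (Fin N → ℤ) → ℝ := fun j => ⨍ y in gridCube h j, f y
  refine ⟨∑ j ∈ J, c j • indicatorConstLp 2 (measurableSet_gridCube h j) (hv j) (1 : ℝ),
    Submodule.sum_mem _ fun j hj => Submodule.smul_mem _ _
      (Submodule.subset_span ⟨j, hj, rfl⟩), ?_⟩
  have hU : MeasurableSet (⋃ j ∈ J, gridCube h j) :=
    Finset.measurableSet_biUnion _ fun j _ => measurableSet_gridCube h j
  have e : ∫⁻ x, ‖(f - ∑ j ∈ J, c j • indicatorConstLp 2 (measurableSet_gridCube h j) (hv j)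
      (1 : ℝ) : BoundaryLp N 2) x‖ₑ ^ 2 =
      ∫⁻ x, ‖f x - ∑ j ∈ J, (gridCube h j).indicator (fun _ => c j) x‖ₑ ^ 2 := by
    refine lintegral_congr_ae ?_
    filter_upwards [Lp.coeFn_sub f (∑ j ∈ J, c j • indicatorConstLp 2
      (measurableSet_gridCube h j) (hv j) (1 : ℝ)),
      coeFn_sum_smul_indicatorConstLp (measurableSet_gridCube h) hv c J] with x h1 h2
    rw [h1, Pi.sub_apply, h2]
  rw [eLpNorm_two_sq, e, ← lintegral_add_compl _ hU, eLpNorm_two_sq]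
  refine add_le_add ?_ (le_of_eq ?_)
  · rw [lintegral_biUnion_finset (fun i _ j _ hij => pairwise_disjoint_gridCube hh hij)
      (fun j _ => measurableSet_gridCube h j)]
    refine le_trans (le_of_eq (Finset.sum_congr rfl fun j hj => ?_))
      (sum_lintegral_sub_average_sq_le (Lp.memLp f) (Lp.stronglyMeasurable f).measurable hh J hη)
    refine setLIntegral_congr_fun (measurableSet_gridCube h j) fun x hx => ?_
    have h3 : ∑ i ∈ J, (gridCube h i).indicator (fun _ => c i) x = c j := by
      rw [Finset.sum_eq_single_of_mem j hj, Set.indicator_of_mem hx]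
      intro i _ hij
      exact Set.indicator_of_notMem
        (fun hi => Set.disjoint_left.1 (pairwise_disjoint_gridCube hh hij) hi hx) _
    rw [h3]
  · refine setLIntegral_congr_fun hU.compl fun x hx => ?_
    have h3 : ∑ i ∈ J, (gridCube h i).indicator (fun _ => c i) x = 0 := by
      refine Finset.sum_eq_zero fun i hi => Set.indicator_of_notMem (fun h4 => hx ?_) _
      exact Set.mem_biUnion (s := (J : Set (Fin N → ℤ))) hi h4
    rw [h3, sub_zero]

theorem exists_cover_ball_gridCube (N : ℕ) {h : ℝ} (hh : 0 < h) (R : ℝ) :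
    ∃ J : Finset (Fin N → ℤ), (⋃ j ∈ J, gridCube h j)ᶜ ⊆
      {x : EuclideanSpace ℝ (Fin N) | R ≤ ‖x‖} := by
  refine ⟨Fintype.piFinset fun _ => Finset.Icc ⌊-R / h⌋ ⌊R / h⌋, fun x hx => ?_⟩
  by_contra hR
  rw [Set.mem_ofPred_eq, not_le] at hR
  refine hx (Set.mem_biUnion (s := (_ : Set (Fin N → ℤ))) ?_ (mem_gridCube_floor hh x))
  rw [Finset.mem_coe, Fintype.mem_piFinset]
  intro i
  have h1 : |x i| ≤ ‖x‖ := PiLp.norm_apply_le x i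
  rw [Finset.mem_Icc]
  have h2 := abs_le.1 (h1.trans hR.le)
  constructor
  · exact Int.floor_le_floor (div_le_div_of_nonneg_right h2.1 hh.le)
  · exact Int.floor_le_floor (div_le_div_of_nonneg_right h2.2 hh.le)

theorem norm_lt_of_mem_centredCube {N : ℕ} {δ : ℝ} (hδ : 0 < δ) {k : EuclideanSpace ℝ (Fin N)}
    (hk : k ∈ centredCube N (δ / (N + 1))) : ‖k‖ < δ := by
  have h1 : ∀ i, ‖k i‖ ^ 2 ≤ (δ / (N + 1)) ^ 2 := fun i => by
    rw [Real.norm_eq_abs, sq_abs]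
    exact sq_le_sq' (hk i).1.le (hk i).2.le
  have h2 : ‖k‖ ^ 2 ≤ N * (δ / (N + 1)) ^ 2 := by
    rw [EuclideanSpace.norm_sq_eq]
    refine (Finset.sum_le_sum fun i _ => h1 i).trans_eq ?_
    simp
  have h3 : (N : ℝ) * (δ / (N + 1)) ^ 2 < δ ^ 2 := by
    have e : δ ^ 2 = (N + 1) ^ 2 * (δ / (N + 1)) ^ 2 := by
      field_simp
    have h4 : 0 < (δ / (N + 1)) ^ 2 := by positivity
    rw [e]
    refine mul_lt_mul_of_pos_right ?_ h4
    nlinarith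
  exact lt_of_pow_lt_pow_left₀ 2 hδ.le (h2.trans_lt h3)

/-- A Kolmogorov-Riesz criterion: an operator into `L²(ℝ^N)` is compact if the images of the unit
ball have uniformly small tails and are uniformly `L²`-continuous under translations. -/
theorem isCompactOperator_of_tail_of_shift {N : ℕ} {E : Type*} [SeminormedAddCommGroup E]
    [NormedSpace ℝ E] (T : E →L[ℝ] BoundaryLp N 2)
    (tail : ∀ ε : ℝ, 0 < ε → ∃ R : ℝ, ∀ v,
      ‖LpToLpRestrictCLM _ ℝ ℝ volume 2 {x | R ≤ ‖x‖} (T v)‖ ≤ ε * ‖v‖)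
    (shift : ∀ ε : ℝ, 0 < ε → ∃ δ : ℝ, 0 < δ ∧ ∀ k, ‖k‖ < δ → ∀ v,
      ‖Lp.compMeasurePreservingₗᵢ ℝ _ (measurePreserving_add_right_volume k) (T v) - T v‖ ≤
        ε * ‖v‖) :
    IsCompactOperator T := by
  refine isCompactOperator_of_finiteDimensional_approx T fun ε hε => ?_
  obtain ⟨R, hR⟩ := tail (ε / 2) (by positivity)
  obtain ⟨δ, hδ, hshift⟩ := shift (ε / 2 / 2 ^ N) (by positivity)
  have hh : 0 < δ / ((N : ℝ) + 1) := by positivity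
  obtain ⟨J, hJ⟩ := exists_cover_ball_gridCube N hh R
  refine ⟨stepSpace (δ / ((N : ℝ) + 1)) J, inferInstance, fun v => ?_⟩
  obtain ⟨g, hg, hgle⟩ := exists_mem_stepSpace (T v) hh J
    (η := ENNReal.ofReal (ε / 2 / 2 ^ N * ‖v‖)) fun k hk => by
    have h1 := hshift k (norm_lt_of_mem_centredCube hδ hk) v
    rw [Lp.norm_def] at h1
    refine le_trans (le_of_eq (eLpNorm_congr_ae ?_))
      ((ENNReal.le_ofReal_iff_toReal_le (Lp.eLpNorm_ne_top _) (by positivity)).2 h1)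
    filter_upwards [Lp.coeFn_sub (Lp.compMeasurePreservingₗᵢ ℝ _
      (measurePreserving_add_right_volume k) (T v)) (T v),
      Lp.coeFn_compMeasurePreserving (T v) (measurePreserving_add_right_volume k)] with x e1 e2
    rw [e1, Pi.sub_apply]
    exact congrArg (· - _) e2.symm
  refine ⟨g, hg, ?_⟩
  have htail : eLpNorm (T v) 2 (volume.restrict (⋃ j ∈ J, gridCube (δ / ((N : ℝ) + 1)) j)ᶜ) ≤
      ENNReal.ofReal (ε / 2 * ‖v‖) := by
    refine (eLpNorm_mono_measure _ (Measure.restrict_mono hJ le_rfl)).trans ?_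
    have h1 := hR v
    rw [norm_LpToLpRestrictCLM] at h1
    exact (ENNReal.le_ofReal_iff_toReal_le ((Lp.memLp (T v)).restrict _).eLpNorm_ne_top
      (by positivity)).2 h1
  have h2 : eLpNorm (T v - g : BoundaryLp N 2) 2 volume ^ 2 ≤
      ENNReal.ofReal (2 ^ N * (ε / 2 / 2 ^ N * ‖v‖) ^ 2 + (ε / 2 * ‖v‖) ^ 2) := by
    refine hgle.trans ?_
    have e : ∀ a b : ℝ, 0 ≤ a → 0 ≤ b → ENNReal.ofReal (2 ^ N * a ^ 2 + b ^ 2) =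
        2 ^ N * ENNReal.ofReal a ^ 2 + ENNReal.ofReal b ^ 2 := by
      intro a b ha hb
      rw [ENNReal.ofReal_add (by positivity) (by positivity), ENNReal.ofReal_mul (by positivity),
        ENNReal.ofReal_pow ha, ENNReal.ofReal_pow hb, ENNReal.ofReal_pow zero_le_two,
        ENNReal.ofReal_ofNat]
    rw [e _ _ (by positivity) (by positivity)]
    exact add_le_add le_rfl (pow_le_pow_left' htail 2)
  have h3 : ‖T v - g‖ ^ 2 ≤ 2 ^ N * (ε / 2 / 2 ^ N * ‖v‖) ^ 2 + (ε / 2 * ‖v‖) ^ 2 := by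
    rw [Lp.norm_def, ← ENNReal.toReal_pow]
    exact ENNReal.toReal_le_of_le_ofReal (by positivity) h2
  refine le_of_sq_le_sq (h3.trans ?_) (by positivity)
  have h4 : (2 : ℝ) ^ N * (ε / 2 / 2 ^ N * ‖v‖) ^ 2 ≤ (ε / 2 * ‖v‖) ^ 2 := by
    have e : (2 : ℝ) ^ N * (ε / 2 / 2 ^ N * ‖v‖) ^ 2 = (ε / 2 * ‖v‖) ^ 2 / 2 ^ N := by
      field_simp
    rw [e]
    exact div_le_self (sq_nonneg _) (one_le_pow₀ one_le_two)
  nlinarith [sq_nonneg (ε * ‖v‖)]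

/-! ### Interpolation and compactness in `L^q` -/

/-- Compactness passes from `T₁` to `T₂` if on bounded sets smallness of `T₁ v` forces smallness
of `T₂ v`. -/
theorem isCompactOperator_of_small {E F₁ F₂ : Type*} [SeminormedAddCommGroup E] [NormedSpace ℝ E]
    [NormedAddCommGroup F₁] [NormedSpace ℝ F₁] [NormedAddCommGroup F₂] [NormedSpace ℝ F₂]
    [CompleteSpace F₂] {T₁ : E →L[ℝ] F₁} {T₂ : E →L[ℝ] F₂} (h₁ : IsCompactOperator T₁)
    (h : ∀ ε : ℝ, 0 < ε → ∃ δ : ℝ, 0 < δ ∧ ∀ v, ‖v‖ ≤ 2 → ‖T₁ v‖ < δ → ‖T₂ v‖ < ε) :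
    IsCompactOperator T₂ := by
  have key : IsCompactOperator (T₂ : E →ₛₗ[RingHom.id ℝ] F₂) := by
    rw [isCompactOperator_iff_isCompact_closure_image_closedBall _ one_pos]
    refine TotallyBounded.isCompact_of_isClosed (TotallyBounded.closure ?_) isClosed_closure
    have h₁' : TotallyBounded (T₁ '' Metric.closedBall 0 1) :=
      (h₁.isCompact_closure_image_closedBall (f := (T₁ : E →ₛₗ[RingHom.id ℝ] F₁))
        1).totallyBounded.subset subset_closure
    rw [Metric.totallyBounded_iff]
    intro ε hε
    obtain ⟨δ, hδ, hsmall⟩ := h ε hε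
    obtain ⟨t, ht, htf, hcov⟩ := Metric.finite_approx_of_totallyBounded h₁' δ hδ
    obtain ⟨s, hs, hsf, rfl⟩ := Set.exists_subset_image_finite_and.1 ⟨t, ht, htf, rfl⟩
    refine ⟨T₂ '' s, hsf.image _, ?_⟩
    rintro _ ⟨v, hv, rfl⟩
    obtain ⟨w, hw, hvw⟩ := Set.mem_iUnion₂.1 (hcov (Set.mem_image_of_mem T₁ hv))
    obtain ⟨u, hu, rfl⟩ := hw
    refine Set.mem_iUnion₂.2 ⟨T₂ u, Set.mem_image_of_mem _ hu, ?_⟩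
    have h1 : ‖v‖ ≤ 1 := mem_closedBall_zero_iff.1 hv
    have h2 : ‖u‖ ≤ 1 := mem_closedBall_zero_iff.1 (hs hu)
    rw [Metric.mem_ball, dist_eq_norm] at hvw ⊢
    rw [← map_sub] at hvw
    -- A difference of two points of the unit ball has norm at most `2`.
    have := hsmall (v - u) (by linarith [norm_sub_le v u]) hvw
    rwa [map_sub] at this
  exact key

/-- The first term dominates for `t ≤ M`, the second for `t ≥ M`. -/
theorem rpow_le_add_of_interpolate {q s t M : ℝ} (ht : 0 ≤ t) (hM : 0 < M) (hq2 : 2 ≤ q)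
    (hqs : q ≤ s) : t ^ q ≤ M ^ (q - 2) * t ^ (2 : ℝ) + M ^ (q - s) * t ^ s := by
  have hM1 : 0 ≤ M ^ (q - 2) * t ^ (2 : ℝ) := by positivity
  have hM2 : 0 ≤ M ^ (q - s) * t ^ s := by positivity
  rcases ht.eq_or_lt with rfl | ht0
  · rw [Real.zero_rpow (by linarith)]
    positivity
  rcases le_total t M with h | h
  · have e : t ^ q = t ^ (q - 2) * t ^ (2 : ℝ) := by
      rw [← Real.rpow_add ht0, sub_add_cancel]
    have : t ^ (q - 2) ≤ M ^ (q - 2) := Real.rpow_le_rpow ht h (by linarith)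
    have h2 : t ^ q ≤ M ^ (q - 2) * t ^ (2 : ℝ) := by
      rw [e]
      gcongr
    linarith
  · have e : t ^ q = t ^ (q - s) * t ^ s := by
      rw [← Real.rpow_add ht0, sub_add_cancel]
    have : t ^ (q - s) ≤ M ^ (q - s) := Real.rpow_le_rpow_of_nonpos hM h (by linarith)
    have h2 : t ^ q ≤ M ^ (q - s) * t ^ s := by
      rw [e]
      gcongr
    linarith

/-- Interpolation between `L²` and `L^s`, with a free parameter `M` that weighs the two terms. -/
theorem eLpNorm_rpow_le_interpolate {α : Type*} [MeasurableSpace α] {μ : Measure α} {f : α → ℝ}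
    (hf : AEStronglyMeasurable f μ) {q s : ℝ≥0} (hq2 : 2 ≤ q) (hqs : q ≤ s) {M : ℝ} (hM : 0 < M) :
    eLpNorm f q μ ^ (q : ℝ) ≤ ENNReal.ofReal (M ^ ((q : ℝ) - 2)) * eLpNorm f 2 μ ^ 2 +
      ENNReal.ofReal (M ^ ((q : ℝ) - s)) * eLpNorm f s μ ^ (s : ℝ) := by
  have hq0 : q ≠ 0 := (zero_lt_two.trans_le hq2).ne'
  have hs0 : s ≠ 0 := (zero_lt_two.trans_le (hq2.trans hqs)).ne'
  rw [eLpNorm_nnreal_pow_eq_lintegral hq0, eLpNorm_nnreal_pow_eq_lintegral hs0, eLpNorm_two_sq,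
    ← lintegral_const_mul' _ _ ENNReal.ofReal_ne_top,
    ← lintegral_const_mul' _ _ ENNReal.ofReal_ne_top,
    ← lintegral_add_left' ((hf.enorm.pow_const 2).const_mul _)]
  refine lintegral_mono fun x => ?_
  have h := ENNReal.ofReal_le_ofReal (rpow_le_add_of_interpolate (norm_nonneg (f x)) hM
    (q := q) (s := s) (by exact_mod_cast hq2) (by exact_mod_cast hqs))
  rwa [ENNReal.ofReal_add (by positivity) (by positivity), ENNReal.ofReal_mul (by positivity),
    ENNReal.ofReal_mul (by positivity),
    ← ENNReal.ofReal_rpow_of_nonneg (norm_nonneg _) (by positivity),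
    ← ENNReal.ofReal_rpow_of_nonneg (norm_nonneg _) (by positivity),
    ← ENNReal.ofReal_rpow_of_nonneg (norm_nonneg _) (by positivity), ofReal_norm,
    ENNReal.rpow_ofNat] at h

/-- An operator into `L²` with an `L^s` bound takes values in `L^q` for `2 ≤ q ≤ s`, is bounded
there, and inherits compactness if `q < s`. -/
theorem exists_operator_Lq {α E : Type*} [MeasurableSpace α] {μ : Measure α}
    [SeminormedAddCommGroup E] [NormedSpace ℝ E] (T : E →L[ℝ] Lp ℝ 2 μ) {q s : ℝ≥0}
    [Fact (1 ≤ (q : ℝ≥0∞))] (hq2 : 2 ≤ q) (hqs : q ≤ s) {K : ℝ≥0}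
    (hK : ∀ v, eLpNorm (T v) s μ ≤ K * ‖v‖ₑ) :
    ∃ T' : E →L[ℝ] Lp ℝ q μ, (∀ v, T' v =ᵐ[μ] T v) ∧
      (q < s → IsCompactOperator T → IsCompactOperator T') := by
  have hq0 : 0 < (q : ℝ) := by exact_mod_cast zero_lt_two.trans_le hq2
  have hs0 : 0 < (s : ℝ) := hq0.trans_le (by exact_mod_cast hqs)
  have hbound : ∀ v {M : ℝ}, 0 < M → eLpNorm (T v) q μ ^ (q : ℝ) ≤
      ENNReal.ofReal (M ^ ((q : ℝ) - 2) * ‖T v‖ ^ 2 +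
        M ^ ((q : ℝ) - s) * (K * ‖v‖) ^ (s : ℝ)) := by
    intro v M hM
    refine (eLpNorm_rpow_le_interpolate (Lp.aestronglyMeasurable _) hq2 hqs hM).trans ?_
    rw [ENNReal.ofReal_add (by positivity) (by positivity), ENNReal.ofReal_mul (by positivity),
      ENNReal.ofReal_mul (by positivity)]
    refine add_le_add (mul_le_mul_right (le_of_eq ?_) _) (mul_le_mul_right ?_ _)
    · rw [ENNReal.ofReal_pow (norm_nonneg _), ofReal_norm, Lp.enorm_def]
    · rw [← ENNReal.ofReal_rpow_of_nonneg (by positivity) hs0.le,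
        ENNReal.ofReal_mul NNReal.zero_le_coe, ENNReal.ofReal_coe_nnreal, ofReal_norm]
      exact ENNReal.rpow_le_rpow (hK v) hs0.le
  have hmem : ∀ v, MemLp (T v) q μ := fun v => by
    refine ⟨Lp.aestronglyMeasurable _, ?_⟩
    rw [← ENNReal.rpow_lt_top_iff_of_pos hq0]
    exact (hbound v one_pos).trans_lt ENNReal.ofReal_lt_top
  let L : E →ₗ[ℝ] Lp ℝ q μ :=
    { toFun := fun v => (hmem v).toLp _
      map_add' := fun v w => by
        rw [← MemLp.toLp_add, MemLp.toLp_eq_toLp_iff, map_add]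
        exact Lp.coeFn_add _ _
      map_smul' := fun c v => by
        rw [RingHom.id_apply, ← MemLp.toLp_const_smul, MemLp.toLp_eq_toLp_iff, map_smul]
        exact Lp.coeFn_smul _ _ }
  have hL : ∀ v {M : ℝ}, 0 < M → ‖L v‖ ^ (q : ℝ) ≤ M ^ ((q : ℝ) - 2) * ‖T v‖ ^ 2 +
      M ^ ((q : ℝ) - s) * (K * ‖v‖) ^ (s : ℝ) := by
    intro v M hM
    have e : ‖L v‖ = (eLpNorm (T v) q μ).toReal := Lp.norm_toLp _ (hmem v)
    rw [e, ENNReal.toReal_rpow]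
    exact ENNReal.toReal_le_of_le_ofReal (by positivity) (hbound v hM)
  have hcont : Continuous L := by
    refine continuous_of_continuousAt_zero L ?_
    rw [ContinuousAt, map_zero, tendsto_zero_iff_norm_tendsto_zero]
    have h1 : Tendsto (fun v : E => (1 : ℝ) ^ ((q : ℝ) - 2) * ‖T v‖ ^ 2 +
        (1 : ℝ) ^ ((q : ℝ) - s) * (K * ‖v‖) ^ (s : ℝ)) (𝓝 0) (𝓝 0) := by
      have hc : Continuous fun v : E => (1 : ℝ) ^ ((q : ℝ) - 2) * ‖T v‖ ^ 2 +
          (1 : ℝ) ^ ((q : ℝ) - s) * (K * ‖v‖) ^ (s : ℝ) := by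
        have := (continuous_const.mul continuous_norm : Continuous fun v : E => (K : ℝ) * ‖v‖)
        have := this.rpow_const (p := (s : ℝ)) fun _ => Or.inr hs0.le
        fun_prop
      have := hc.tendsto 0
      simpa [hs0.ne'] using this
    have h2 : Tendsto (fun v => ‖L v‖ ^ (q : ℝ)) (𝓝 0) (𝓝 0) :=
      squeeze_zero (fun v => by positivity) (fun v => hL v one_pos) h1
    have h3 := h2.rpow_const (p := (q : ℝ)⁻¹) (Or.inr (by positivity))
    rw [Real.zero_rpow (by positivity)] at h3
    refine h3.congr fun v => ?_
    exact Real.rpow_rpow_inv (norm_nonneg _) hq0.ne'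
  refine ⟨⟨L, hcont⟩, fun v => (hmem v).coeFn_toLp, fun hlt hT =>
    isCompactOperator_of_small hT fun ε hε => ?_⟩
  have hlt' : (q : ℝ) - s < 0 := by
    rw [sub_neg]
    exact_mod_cast hlt
  -- For `M` large the `L^s` term is small uniformly on bounded sets; then choose `δ`.
  have hM : Tendsto (fun M : ℝ => M ^ ((q : ℝ) - s) * (K * 2 : ℝ) ^ (s : ℝ)) atTop (𝓝 0) := by
    have := (tendsto_rpow_neg_atTop (neg_pos.2 hlt')).mul_const ((K * 2 : ℝ) ^ (s : ℝ))
    simpa using this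
  have hε2 : 0 < ε ^ (q : ℝ) / 2 := by positivity
  obtain ⟨M, hMle, hM0⟩ := ((hM.eventually_lt_const hε2).and (eventually_gt_atTop 0)).exists
  have hM2 : 0 < M ^ ((q : ℝ) - 2) := Real.rpow_pos_of_pos hM0 _
  refine ⟨√(ε ^ (q : ℝ) / 2 / M ^ ((q : ℝ) - 2)), Real.sqrt_pos.2 (by positivity),
    fun v hv hδ => ?_⟩
  have h1 : ‖T v‖ ^ 2 < ε ^ (q : ℝ) / 2 / M ^ ((q : ℝ) - 2) := (Real.lt_sqrt (norm_nonneg _)).1 hδ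
  rw [lt_div_iff₀' hM2] at h1
  have h2 : M ^ ((q : ℝ) - s) * (K * ‖v‖) ^ (s : ℝ) ≤ M ^ ((q : ℝ) - s) * (K * 2) ^ (s : ℝ) := by
    gcongr
  have h3 : ‖L v‖ ^ (q : ℝ) < ε ^ (q : ℝ) := by linarith [hL v hM0]
  exact (Real.rpow_lt_rpow_iff (norm_nonneg _) hε.le hq0).1 h3

/-- The `L²` trace of the energy space is compact. -/
theorem IsTraceOperator.isCompactOperator {N : ℕ} (hN : 1 ≤ N)
    {tr : SobolevH1 N →L[ℝ] BoundaryLp N 2} (h : IsTraceOperator tr) :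
    IsCompactOperator (tr ∘L EnergySpace.toH1L hN) := by
  refine isCompactOperator_of_tail_of_shift _ (fun ε hε => ?_) fun ε hε => ?_
  -- Over `|x| ≥ R` the squared `L²` norm of the trace is at most `2 ‖v‖ ‖∇v‖`, where the `L²` norm
  -- of `v` there is at most `1 / R` times the energy norm; `R = 2 / ε²` turns `2 / R` into `ε²`.
  · have hR : 0 < 2 / ε ^ 2 := by positivity
    refine ⟨2 / ε ^ 2, fun v => ?_⟩
    have h1 := h.norm_restrict_sq_le {x | 2 / ε ^ 2 ≤ ‖x‖} (EnergySpace.toH1 N v)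
    have h2 := v.mul_norm_restrict_le hR.le
    rw [div_mul_eq_mul_div, div_le_iff₀ (by positivity)] at h2
    refine le_of_sq_le_sq (h1.trans ?_) (by positivity)
    rw [← mul_assoc, mul_pow]
    calc _ ≤ ‖v‖ * ε ^ 2 * ‖v‖ :=
          mul_le_mul h2 v.norm_grad_le (norm_nonneg _) (by positivity)
      _ = _ := by ring
  · refine ⟨ε ^ 2 / 4, by positivity, fun k hk v => ?_⟩
    refine le_of_sq_le_sq ((h.norm_shift_sub_sq_le k (EnergySpace.toH1 N v)).trans ?_)
      (by positivity)
    rw [mul_pow]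
    have h1 := v.norm_grad_le
    have h2 : 4 * ‖k‖ ≤ ε ^ 2 := by linarith
    gcongr

end HarmonicTrace

end

theorem proposition1p1 (N : ℕ) (hN : 2 ≤ N) :
    (∃! tr : HarmonicTrace.SobolevH1 N →L[ℝ] HarmonicTrace.BoundaryLp N 2,
      HarmonicTrace.IsTraceOperator tr) ∧
    ∀ tr : HarmonicTrace.SobolevH1 N →L[ℝ] HarmonicTrace.BoundaryLp N 2,
      HarmonicTrace.IsTraceOperator tr →
      ∀ (q : ℝ≥0∞) [Fact (1 ≤ q)], 2 ≤ q →
        q ≤ ENNReal.ofReal (2 * (N : ℝ) / ((N : ℝ) - 1)) →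
        ∃ T : HarmonicTrace.EnergySpace N →L[ℝ] HarmonicTrace.BoundaryLp N q,
          (∀ v : HarmonicTrace.EnergySpace N,
            T v =ᵐ[volume] tr (HarmonicTrace.EnergySpace.toH1 N v)) ∧
          (q < ENNReal.ofReal (2 * (N : ℝ) / ((N : ℝ) - 1)) → IsCompactOperator T) := by
  refine ⟨HarmonicTrace.existsUnique_isTraceOperator N, fun tr htr q hq hq2 hqs => ?_⟩
  have hN1 : 1 ≤ N := one_le_two.trans hN
  obtain ⟨K, hK⟩ := HarmonicTrace.IsTraceOperator.exists_eLpNorm_le hN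
  lift q to NNReal using (hqs.trans_lt ENNReal.ofReal_lt_top).ne
  obtain ⟨T, hT, hTc⟩ := HarmonicTrace.exists_operator_Lq
    (tr ∘L HarmonicTrace.EnergySpace.toH1L hN1) (q := q)
    (s := (2 * (N : ℝ) / ((N : ℝ) - 1)).toNNReal) (K := K) (by exact_mod_cast hq2)
    (ENNReal.coe_le_coe.1 hqs) fun v => by
      refine (hK tr htr (HarmonicTrace.EnergySpace.toH1 N v)).trans (mul_le_mul_right ?_ _)
      exact enorm_le_iff_norm_le.2 v.norm_grad_le
  exact ⟨T, hT, fun hlt => hTc (ENNReal.coe_lt_coe.1 hlt) (htr.isCompactOperator hN1)⟩
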